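/- Work over $\mathbb{C}$. Let $n\ge 1$ and let $\underline a=(a_1,\dots,a_m)$, $\underline b=(b_1,\dots,b_t)$ be (possibly empty) sequences of positive integers with $\sum a_i\le n$ and $\sum b_j\le n$. Let $\mathfrak{sp}(2n)$ be the Lie algebra of all $X\in M_{2n}(\mathbb{C})$ with $X_{2n+1-j,\,2n+1-i}=-\varepsilon_i\varepsilon_jX_{i,j}$ for all $i,j$, where $\varepsilon_i=1$ for $i\le n$ and $\varepsilon_i=-1$ for $i>n$. Divide $1,\dots,2n$ into consecutive blocks of sizes $a_1,\dots,a_m,\,2(n-\sum a_i),\,a_m,\dots,a_1$ (the $a$-blocks) and likewise into $b$-blocks. The type-C seaweed $\mathfrak g=\mathfrak p_{2n}^C\frac{a_1|\dots|a_m}{b_1|\dots|b_t}$ is the Lie algebra of all $X\in\mathfrak{sp}(2n)$ whose entry $X_{i,j}$ vanishes unless $i\ge j$ and $i,j$ lie in one $a$-block, or $i\le j$ and $i,j$ lie in one $b$-block. The homotopy type of $\mathfrak g$ is found as follows. Start with the fraction $\frac{a_1|\dots|a_m}{b_1|\dots|b_t}$ on $n$ vertices. While numerator and denominator are both non-empty,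 with first parts $a_1$ and $b_1$, apply the one applicable move: * if $a_1>2b_1$, pass to $\frac{(a_1-2b_1)|b_1|a_2|\cdots}{b_2|\cdots}$; * if $a_1=2b_1$, pass to $\frac{b_1|a_2|\cdots}{b_2|\cdots}$; * if $b_1<a_1<2b_1$, pass to $\frac{b_1|a_2|\cdots}{(2b_1-a_1)|b_2|\cdots}$; * if $a_1=b_1$, pass to $\frac{a_2|\cdots}{b_2|\cdots}$ (deletion of a component of size $a_1$); * if $a_1<b_1$, exchange numerator and denominator. At each move other than the exchange, the number of vertices decreases by the decrease of the sum of the numerator (which equals that of the denominator). If the process ends with $k$ vertices, with $c_1|\dots|c_q$ on one side and with the other side empty, then the sizes of the deleted components, in order, are the first entries of the homotopy type, $c_1,\dots,c_q$ are its tail entries, and $2(k-\sum c_i)$ is its aftertail entry. Assume that no component is deleted, that all tail entries are $1$ (there may be none), and that the aftertail entry is $2$; that is, $\mathfrak g$ has homotopy type $\mathcal H_C(1,\dots,1,2)$ with tail entries $1,\dots,1$ and aftertail entry $2$. The oriented full meander of $\mathfrak g$ has vertices $v_1,\dots,v_{2n}$; its edges $(v_i,v_j)$ are those with $i>j$ where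 $i,j$ are mirror images of each other in an $a$-block, and those with $i<j$ where $i,j$ are mirror images of each other in a $b$-block (that is, $i+j$ is the sum of the first and the last element of the block). Let $e_{i,j}$ be the matrix units, let $e_{i,j}^*$ be the one-form $X\mapsto X_{i,j}$ on $\mathfrak g$, and let $$\varphi=e_{n,n}^*+\sum_{(v_i,v_j)}e_{i,j}^*\in\mathfrak g^*,$$ where the sum is over all edges $(v_i,v_j)$ of the oriented full meander with $i\le n-1$ or $j\le n-1$. Let $B_\varphi(x,y)=\varphi([x,y])$ be the Kirillov form of $\varphi$ on $\mathfrak g$. Then $e_{n,n}-e_{n+1,n+1}\in\mathfrak g$ and $$\ker(B_\varphi)=\{x\in\mathfrak g : B_\varphi(x,y)=0\text{ for all }y\in\mathfrak g\}=\operatorname{span}_{\mathbb C}\{e_{n,n}-e_{n+1,n+1}\}.$$ -/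

import Mathlib

attribute [local instance 100] LieRing.ofAssociativeRing

namespace TypeCSeaweed

/-- For a list `l` of block sizes, the `0`-based position `i` lies in the `k`-th block of `l`. -/
def InBlock (l : List ℕ) (k i : ℕ) : Prop :=
  (l.take k).sum ≤ i ∧ i < (l.take (k + 1)).sum

/-- The positions `i` and `j` lie in one and the same block of `l`. -/
def SameBlock (l : List ℕ) (i j : ℕ) : Prop :=
  ∃ k, InBlock l k i ∧ InBlock l k j

/-- The palindromic list `a₁ | … | aₘ | 2(n - ∑ aᵢ) | aₘ | … | a₁` of block sizes, which is a
composition of `2n` (up to a possible empty middle block) when `∑ aᵢ ≤ n`. -/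
def fullComposition (n : ℕ) (a : List ℕ) : List ℕ :=
  a ++ (2 * (n - a.sum)) :: a.reverse

/-- The location `(i, j)` is admissible: on or below the diagonal inside a block of the full
composition of `a`, or on or above the diagonal inside a block of the full composition of `b`. -/
def Admissible (n : ℕ) (a b : List ℕ) (i j : ℕ) : Prop :=
  (j ≤ i ∧ SameBlock (fullComposition n a) i j) ∨ (i ≤ j ∧ SameBlock (fullComposition n b) i j)

theorem SameBlock.symm {l : List ℕ} {i j : ℕ} (h : SameBlock l i j) : SameBlock l j i := by
  obtain ⟨k, h1, h2⟩ := h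
  exact ⟨k, h2, h1⟩

theorem take_sum_mono (l : List ℕ) {p q : ℕ} (h : p ≤ q) : (l.take p).sum ≤ (l.take q).sum :=
  (List.take_sublist_take_left h).sum_le_sum (by simp)

theorem InBlock.unique {l : List ℕ} {k m i : ℕ} (h : InBlock l k i) (h' : InBlock l m i) :
    k = m := by
  rcases lt_trichotomy k m with hlt | heq | hlt
  · have := take_sum_mono l (show k + 1 ≤ m from hlt)
    have h1 := h.2
    have h2 := h'.1
    omega
  · exact heq
  · have := take_sum_mono l (show m + 1 ≤ k from hlt)
    have h1 := h'.2
    have h2 := h.1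
    omega

theorem SameBlock.trans {l : List ℕ} {i j k : ℕ} (h : SameBlock l i j) (h' : SameBlock l j k) :
    SameBlock l i k := by
  obtain ⟨p, h1, h2⟩ := h
  obtain ⟨q, h3, h4⟩ := h'
  obtain rfl := h2.unique h3
  exact ⟨p, h1, h4⟩

theorem SameBlock.between {l : List ℕ} {i j k : ℕ} (h : SameBlock l i k) (hij : i ≤ j)
    (hjk : j ≤ k) : SameBlock l i j := by
  obtain ⟨p, h1, h2⟩ := h
  exact ⟨p, h1, le_trans h1.1 hij, lt_of_le_of_lt hjk h2.2⟩

theorem Admissible.trans {n : ℕ} {a b : List ℕ} {i j k : ℕ} (h : Admissible n a b i j)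
    (h' : Admissible n a b j k) : Admissible n a b i k := by
  rcases h with ⟨hij, h⟩ | ⟨hij, h⟩ <;> rcases h' with ⟨hjk, h'⟩ | ⟨hjk, h'⟩
  · exact Or.inl ⟨hjk.trans hij, h.trans h'⟩
  · rcases le_total k i with hki | hki
    · exact Or.inl ⟨hki, h.trans (h.symm.between hjk hki)⟩
    · exact Or.inr ⟨hki, (h'.between hij hki).symm.trans h'⟩
  · rcases le_total k i with hki | hki
    · exact Or.inl ⟨hki, (h'.symm.between hki hij).symm⟩
    · exact Or.inr ⟨hki, h.between hki hjk⟩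
  · exact Or.inr ⟨hij.trans hjk, h.trans h'⟩

/-- The matrices of size `2n` which vanish outside the admissible locations, that is, the sum of
the space of block-diagonal lower triangular matrices with blocks `fullComposition n a` and the
space of block-diagonal upper triangular matrices with blocks `fullComposition n b`. -/
def admissibleMatrices (n : ℕ) (a b : List ℕ) :
    LieSubalgebra ℂ (Matrix (Fin (2 * n)) (Fin (2 * n)) ℂ) where
  carrier := {X | ∀ i j : Fin (2 * n), ¬ Admissible n a b i j → X i j = 0}
  add_mem' {X Y} hX hY i j h := by simp [hX i j h, hY i j h]
  zero_mem' i j _ := rfl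
  smul_mem' c X hX i j h := by simp [hX i j h]
  lie_mem' {X Y} hX hY i j h := by
    have key : ∀ A B : Matrix (Fin (2 * n)) (Fin (2 * n)) ℂ,
        (∀ i j : Fin (2 * n), ¬ Admissible n a b i j → A i j = 0) →
        (∀ i j : Fin (2 * n), ¬ Admissible n a b i j → B i j = 0) → (A * B) i j = 0 := by
      intro A B hA hB
      rw [Matrix.mul_apply]
      refine Finset.sum_eq_zero fun k _ => ?_
      by_cases h1 : Admissible n a b i k
      · rw [hB k j fun h2 => h (h1.trans h2), mul_zero]
      · rw [hA i k h1, zero_mul]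
    rw [Ring.lie_def, Matrix.sub_apply, key X Y hX hY, key Y X hY hX, sub_zero]

/-- The antidiagonal matrix with entries `1` in its upper half and `-1` in its lower half. -/
def antidiagonalJ (n : ℕ) : Matrix (Fin (2 * n)) (Fin (2 * n)) ℂ :=
  Matrix.of fun i j => if (i : ℕ) + j + 1 = 2 * n then (if (i : ℕ) < n then 1 else -1) else 0

/-- The symplectic Lie algebra `𝔰𝔭(2n)` over `ℂ`, in the form that is symmetric about the
antidiagonal: spanned by `e_{i,j} - e_{2n-j+1,2n-i+1}` (`i, j ≤ n`), by
`e_{i,j} + e_{2n-j+1,2n-i+1}` (one of `i, j` at most `n`, the other one larger) and by the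
`e_{i,2n+1-i}`. -/
def sp (n : ℕ) : LieSubalgebra ℂ (Matrix (Fin (2 * n)) (Fin (2 * n)) ℂ) :=
  skewAdjointMatricesLieSubalgebra (antidiagonalJ n)

/-- The type-C seaweed `𝔭_{2n}^C (a₁|…|aₘ)/(b₁|…|bₜ)`. -/
def seaweed (n : ℕ) (a b : List ℕ) : LieSubalgebra ℂ (Matrix (Fin (2 * n)) (Fin (2 * n)) ℂ) :=
  sp n ⊓ admissibleMatrices n a b

/-- `HomotopyTypeC n a b D c r` says that winding down the meander on `n` vertices of fractional
form `a / b` performs the component deletions `C(d)` with `d` running through `D`, in this order,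
and ends at a meander of fractional form `c / ∅` (or `∅ / c`, its flip) on `k` vertices with
`r = 2 (k - ∑ c)`; thus the type-C homotopy type has the deleted components `D`, the tail
components `c` and the aftertail component `r`. -/
inductive HomotopyTypeC : ℕ → List ℕ → List ℕ → List ℕ → List ℕ → ℕ → Prop
  | doneBot (n : ℕ) (c : List ℕ) : HomotopyTypeC n c [] [] c (2 * (n - c.sum))
  | doneTop (n : ℕ) (c : List ℕ) : HomotopyTypeC n [] c [] c (2 * (n - c.sum))
  | pureContraction {n x y : ℕ} {a b D c : List ℕ} {r : ℕ} (h : 2 * y < x) :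
      HomotopyTypeC (n - y) ((x - 2 * y) :: y :: a) b D c r →
      HomotopyTypeC n (x :: a) (y :: b) D c r
  | blockElimination {n x y : ℕ} {a b D c : List ℕ} {r : ℕ} (h : x = 2 * y) :
      HomotopyTypeC (n - y) (y :: a) b D c r →
      HomotopyTypeC n (x :: a) (y :: b) D c r
  | rotationContraction {n x y : ℕ} {a b D c : List ℕ} {r : ℕ} (h : y < x) (h' : x < 2 * y) :
      HomotopyTypeC (n - (x - y)) (y :: a) ((2 * y - x) :: b) D c r →
      HomotopyTypeC n (x :: a) (y :: b) D c r
  | componentDeletion {n x : ℕ} {a b D c : List ℕ} {r : ℕ} :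
      HomotopyTypeC (n - x) a b D c r →
      HomotopyTypeC n (x :: a) (x :: b) (x :: D) c r
  | flip {n x y : ℕ} {a b D c : List ℕ} {r : ℕ} (h : x < y) :
      HomotopyTypeC n (y :: b) (x :: a) D c r →
      HomotopyTypeC n (x :: a) (y :: b) D c r

/-- `i` and `j` are the distinct endpoints of an arc of the meander with blocks `l`: they are
mirror images of each other in some block of `l`. -/
def IsArc (l : List ℕ) (i j : ℕ) : Prop :=
  i ≠ j ∧ ∃ k, InBlock l k i ∧ InBlock l k j ∧ i + j + 1 = (l.take k).sum + (l.take (k + 1)).sum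

/-- `(v_i, v_j)` (with `0`-based labels) is an edge of the full meander on `2n` vertices with its
counterclockwise orientation: top arcs, given by `a`, run from right to left, and bottom arcs,
given by `b`, from left to right. -/
def OrientedFullMeanderEdge (n : ℕ) (a b : List ℕ) (i j : ℕ) : Prop :=
  (j < i ∧ IsArc (fullComposition n a) i j) ∨ (i < j ∧ IsArc (fullComposition n b) i j)

open Classical in
/-- The edges `(v_i, v_j)` of the oriented full meander for which one of the `1`-based labels
`i + 1`, `j + 1` is at most `n - 1`. -/
noncomputable def formEdges (n : ℕ) (a b : List ℕ) : Finset (Fin (2 * n) × Fin (2 * n)) :=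
  Finset.univ.filter fun p =>
    OrientedFullMeanderEdge n a b p.1 p.2 ∧ ((p.1 : ℕ) + 1 ≤ n - 1 ∨ (p.2 : ℕ) + 1 ≤ n - 1)

/-- The one-form `e_{i,j}^*` on a Lie algebra of matrices: it returns the `(i, j)` entry. -/
def entryForm {m : ℕ} (g : LieSubalgebra ℂ (Matrix (Fin m) (Fin m) ℂ)) (i j : Fin m) :
    Module.Dual ℂ g :=
  Matrix.entryLinearMap ℂ ℂ i j ∘ₗ g.toSubmodule.subtype

/-- The (`1`-based) index `n` among `1, …, 2n`. -/
def idxN {n : ℕ} (hn : 0 < n) : Fin (2 * n) := ⟨n - 1, by omega⟩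

/-- The (`1`-based) index `n + 1` among `1, …, 2n`. -/
def idxNSucc {n : ℕ} (hn : 0 < n) : Fin (2 * n) := ⟨n, by omega⟩

/-- The one-form `e_{n,n}^* + ∑ e_{i,j}^*`, the sum being over the edges `(v_i, v_j)` of the
oriented full meander with `i ≤ n - 1` or `j ≤ n - 1`. -/
noncomputable def aftertailForm {n : ℕ} (hn : 0 < n) (a b : List ℕ) :
    Module.Dual ℂ (seaweed n a b) :=
  entryForm _ (idxN hn) (idxN hn) + ∑ p ∈ formEdges n a b, entryForm _ p.1 p.2

/-- The Kirillov form `B_φ(x, y) = φ [x, y]`. -/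
def kirillovForm {L : Type*} [LieRing L] [LieAlgebra ℂ L] (φ : Module.Dual ℂ L) :
    LinearMap.BilinForm ℂ L :=
  LinearMap.mk₂ ℂ (fun x y => φ ⁅x, y⁆) (by simp) (by simp) (by simp) (by simp)

end TypeCSeaweed

/-!
With respect to the trace form, `φ` is represented by the `0`-`1` matrix `f` of the chosen edges and
of `e_{n,n}`, and `x` is in the kernel iff `[f, x]` is orthogonal to `𝔤`. The sum of one of the two
sequences is `N = n - 1`, the larger possible value; let it be `∑ aᵢ`, transposing if necessary.

By the symmetry about the antidiagonal, such an `x` is determined by its first `n` rows. On the tail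
`T = [∑ bⱼ, N)` the equations force the upper left `N × N` block of `x` to be skew, and they make
the coadjoint action of this block on the form of the arcs equal to a symmetric matrix on `T`, the
symmetrized part of `x` beyond the middle. These are the equations of a type-A seaweed, and they
have the trivial solution only: each winding-down move turns a solution into a solution for the
smaller meander without losing information, and at the end, where all tail blocks have size one, a
triangular matrix which is skew vanishes. Direct tests kill the remaining entries near the middle,
apart from the multiples of `e_{n,n} - e_{n+1,n+1}`.
-/

namespace TypeCSeaweed

/-! ### Kernel equations of a pair of block patterns -/

/-- A division of an interval of positions into consecutive blocks, given by the relation of lying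
in the same block, together with the map which exchanges the two ends of every arc and fixes the
positions without an arc. -/
structure BlockPattern where
  rel : ℕ → ℕ → Prop
  mirror : ℕ → ℕ
  symm : ∀ {i j}, rel i j → rel j i

namespace BlockPattern

section KernelEquations

/-- The pattern with the block `[s, e)` and all its arcs put in front of `P`. -/
def cons (s e : ℕ) (P : BlockPattern) : BlockPattern where
  rel i j := (i ∈ Set.Ico s e ∧ j ∈ Set.Ico s e) ∨ P.rel i j
  mirror i := if i ∈ Set.Ico s e then s + e - 1 - i else P.mirror i
  symm h := h.imp And.symm P.symm

/-- All positions of the pattern are at least `m`. -/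
structure StartsAt (P : BlockPattern) (m : ℕ) : Prop where
  le_left : ∀ {i j}, P.rel i j → m ≤ i
  mapsTo : Set.MapsTo P.mirror (Set.Ici m) (Set.Ici m)

variable {P Q : BlockPattern} {s m e i j : ℕ}

theorem cons_rel :
    (P.cons s e).rel i j ↔ (s ≤ i ∧ i < e) ∧ (s ≤ j ∧ j < e) ∨ P.rel i j :=
  Iff.rfl

theorem cons_mirror_of_mem (hs : s ≤ i) (he : i < e) : (P.cons s e).mirror i = s + e - 1 - i :=
  if_pos ⟨hs, he⟩

theorem cons_mirror_of_lt (h : i < s) : (P.cons s e).mirror i = P.mirror i :=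
  if_neg fun hi => h.not_ge hi.1

theorem cons_mirror_of_le (h : e ≤ i) : (P.cons s e).mirror i = P.mirror i :=
  if_neg fun hi => hi.2.not_ge h

theorem StartsAt.le_right (hP : P.StartsAt m) (h : P.rel i j) : m ≤ j :=
  hP.le_left (P.symm h)

theorem StartsAt.mono (hP : P.StartsAt e) (hi : e ≤ i) : e ≤ P.mirror i :=
  hP.mapsTo hi

theorem StartsAt.cons (hP : P.StartsAt e) (hse : s ≤ e) : (P.cons s e).StartsAt s where
  le_left h := by
    rcases h with h | h
    · exact h.1.1
    · exact hse.trans (hP.le_left h)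
  mapsTo i hi := by
    simp only [Set.mem_Ici] at hi ⊢
    rcases lt_or_ge i e with h | h
    · rw [cons_mirror_of_mem hi h]
      omega
    · rw [cons_mirror_of_le h]
      exact hse.trans (hP.mono h)

theorem cons_self (s : ℕ) (P : BlockPattern) : P.cons s s = P := by
  simp [cons]

/-- The positions at which the seaweed with blocks `P` below and `Q` above the diagonal has
entries. -/
def Allowed (P Q : BlockPattern) (i j : ℕ) : Prop :=
  (j ≤ i ∧ P.rel i j) ∨ (i ≤ j ∧ Q.rel i j)

theorem Allowed.swap (h : Allowed P Q i j) : Allowed Q P j i :=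
  (h.imp (And.imp_right P.symm) (And.imp_right Q.symm)).symm

variable {K : Type*} [CommRing K]

/-- The entry `(j, i)` of the product `f x`. Here `f` is the `0`-`1` matrix which represents the
form of the arcs of `P`, directed to the left, and of `Q`, directed to the right: this form is
`y ↦ tr (f y)`. -/
def arcRow (P Q : BlockPattern) (x : Matrix ℕ ℕ K) (j i : ℕ) : K :=
  (if j < P.mirror j then x (P.mirror j) i else 0) +
    (if Q.mirror j < j then x (Q.mirror j) i else 0)

/-- The entry `(j, i)` of `[f, x]`, where `f` is the matrix of `arcRow`; the transpose of `f`
belongs to the patterns in the opposite order. -/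
def arcBracket (P Q : BlockPattern) (x : Matrix ℕ ℕ K) (j i : ℕ) : K :=
  arcRow P Q x j i - arcRow Q P x.transpose i j

theorem arcBracket_transpose (x : Matrix ℕ ℕ K) (i j : ℕ) :
    arcBracket Q P x.transpose i j = -arcBracket P Q x j i := by
  rw [arcBracket, arcBracket, Matrix.transpose_transpose, neg_sub]

theorem arcRow_congr {A : Set ℕ} (hP : Set.MapsTo P.mirror A A) (hQ : Set.MapsTo Q.mirror A A)
    {x y : Matrix ℕ ℕ K} (hxy : ∀ k ∈ A, x k i = y k i) (hj : j ∈ A) :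
    arcRow P Q x j i = arcRow P Q y j i := by
  rw [arcRow, arcRow, hxy _ (hP hj), hxy _ (hQ hj)]

theorem arcBracket_congr {A : Set ℕ} (hP : Set.MapsTo P.mirror A A)
    (hQ : Set.MapsTo Q.mirror A A) {x y : Matrix ℕ ℕ K}
    (hxy : ∀ k ∈ A, ∀ l ∈ A, x k l = y k l) (hi : i ∈ A) (hj : j ∈ A) :
    arcBracket P Q x j i = arcBracket P Q y j i := by
  rw [arcBracket, arcBracket, arcRow_congr hP hQ (fun k hk => hxy k hk i hi) hj,
    arcRow_congr hQ hP (y := y.transpose) (fun k hk => hxy j hj k hk) hi]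

/-- The matrix `x` is in the seaweed of `P` and `Q` and is skew on the tail `T`, and its coadjoint
action on the form `f` of the arcs is the form of the symmetric matrix `S` on `T`. In type C, the
entries of `S` come from the block of `x` beyond the diagonal blocks. -/
structure IsKernelPair (P Q : BlockPattern) (T : Set ℕ) (x S : Matrix ℕ ℕ K) : Prop where
  support : ∀ {i j}, ¬ Allowed P Q i j → x i j = 0
  skew : ∀ {i j}, i ∈ T → j ∈ T → x i j = -x j i
  isSymm : S.IsSymm
  eq_zero_off : ∀ {i j}, ¬ (i ∈ T ∧ j ∈ T) → S i j = 0
  bracket : ∀ {i j}, Allowed P Q i j → arcBracket P Q x j i = S j i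

variable (K) in
/-- The kernel equations of `IsKernelPair` have the trivial solution only. -/
def Rigid (P Q : BlockPattern) (T : Set ℕ) : Prop :=
  ∀ x S : Matrix ℕ ℕ K, IsKernelPair P Q T x S → x = 0 ∧ S = 0

variable {T : Set ℕ}

theorem IsKernelPair.transpose {x S : Matrix ℕ ℕ K} (h : IsKernelPair P Q T x S) :
    IsKernelPair Q P T x.transpose (-S) where
  support hij := h.support fun hji => hij hji.swap
  skew hi hj := h.skew hj hi
  isSymm := h.isSymm.neg
  eq_zero_off hij := by rw [Matrix.neg_apply, h.eq_zero_off hij, neg_zero]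
  bracket {i j} hij := by
    rw [arcBracket_transpose, h.bracket hij.swap, Matrix.neg_apply, h.isSymm.apply]

theorem Rigid.flip (h : Rigid K P Q T) : Rigid K Q P T := fun x S hx => by
  obtain ⟨hx0, hS0⟩ := h _ _ hx.transpose
  exact ⟨Matrix.transpose_eq_zero.1 hx0, neg_eq_zero.1 hS0⟩

section LeadingBlocks

variable {x S : Matrix ℕ ℕ K}

theorem IsKernelPair.apply_eq_zero_of_lt_of_le (h : IsKernelPair (P.cons s e) (Q.cons s m) T x S)
    (hQ : Q.StartsAt m) (hi : i < m) (hj : m ≤ j) : x i j = 0 := by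
  refine h.support ?_
  rintro (⟨hji, -⟩ | ⟨-, hij | hij⟩)
  · omega
  · exact hij.2.2.not_ge hj
  · exact hi.not_ge (hQ.le_left hij)

theorem IsKernelPair.apply_eq_zero_of_le_of_lt (h : IsKernelPair (P.cons s e) (Q.cons s m) T x S)
    (hP : P.StartsAt e) (hi : e ≤ i) (hj : j < e) : x i j = 0 := by
  refine h.support ?_
  rintro (⟨-, hij | hij⟩ | ⟨hij, -⟩)
  · exact hij.1.2.not_ge hi
  · exact hj.not_ge (hP.le_right hij)
  · omega

theorem IsKernelPair.apply_eq_zero_of_lt (h : IsKernelPair (P.cons s e) (Q.cons s m) T x S)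
    (hse : s ≤ e) (hsm : s ≤ m) (hP : P.StartsAt e) (hQ : Q.StartsAt m) (hij : i < s ∨ j < s) :
    x i j = 0 := by
  refine h.support fun hal => ?_
  have hsij : s ≤ i ∧ s ≤ j := by
    rcases hal with ⟨-, hr⟩ | ⟨-, hr⟩
    exacts [⟨(hP.cons hse).le_left hr, (hP.cons hse).le_right hr⟩,
      ⟨(hQ.cons hsm).le_left hr, (hQ.cons hsm).le_right hr⟩]
  omega

theorem allowed_of_le (hji : j ≤ i) (hs : s ≤ j) (he : i < e) : Allowed (P.cons s e) Q i j :=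
  Or.inl ⟨hji, Or.inl ⟨⟨hs.trans hji, he⟩, hs, hji.trans_lt he⟩⟩

theorem allowed_of_mem_Ico (hme : m ≤ e) (hi : s ≤ i) (hi' : i < m) (hj : s ≤ j) (hj' : j < m) :
    Allowed (P.cons s e) (Q.cons s m) i j := by
  rcases le_total j i with hji | hij
  · exact allowed_of_le hji hj (hi'.trans_le hme)
  · exact Or.inr ⟨hij, Or.inl ⟨⟨hi, hi'⟩, hj, hj'⟩⟩

theorem IsKernelPair.intertwine (h : IsKernelPair (P.cons s e) (Q.cons s m) T x S)
    (hQ : Q.StartsAt m) (hT : T ⊆ Set.Ici m) (hj : s ≤ j) (hj' : j < m) (hi : m ≤ i)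
    (hi' : i < e) :
    (if j < s + e - 1 - j then x (s + e - 1 - j) i else 0) =
      if s + e - 1 - i < i then x j (s + e - 1 - i) else 0 := by
  have hE := h.bracket (allowed_of_le (by omega) hj hi')
  rw [h.eq_zero_off fun hji => (hT hji.1).not_gt hj'] at hE
  simp only [arcBracket, arcRow, Matrix.transpose_apply] at hE
  rw [cons_mirror_of_mem hj (by omega), cons_mirror_of_mem (by omega) hi',
    cons_mirror_of_mem hj hj', cons_mirror_of_le hi,
    h.apply_eq_zero_of_lt_of_le hQ (i := s + m - 1 - j) (by omega) hi,
    h.apply_eq_zero_of_lt_of_le hQ hj' (hQ.mono hi)] at hE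
  simpa [sub_eq_zero] using hE

theorem IsKernelPair.square (h : IsKernelPair (P.cons s e) (Q.cons s m) T x S) (hme : m ≤ e)
    (hT : T ⊆ Set.Ici m) (hi : s ≤ i) (hi' : i < m) (hj : s ≤ j) (hj' : j < m) :
    (if j < s + e - 1 - j then x (s + e - 1 - j) i else 0) +
        (if s + m - 1 - j < j then x (s + m - 1 - j) i else 0) -
      ((if i < s + m - 1 - i then x j (s + m - 1 - i) else 0) +
        (if s + e - 1 - i < i then x j (s + e - 1 - i) else 0)) = 0 := by
  have hE := h.bracket (allowed_of_mem_Ico hme hi hi' hj hj')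
  rw [h.eq_zero_off fun hji => (hT hji.1).not_gt hj', arcBracket, arcRow, arcRow,
    cons_mirror_of_mem hj (by omega), cons_mirror_of_mem hj hj', cons_mirror_of_mem hi hi',
    cons_mirror_of_mem hi (by omega)] at hE
  exact hE

end LeadingBlocks

end KernelEquations

/-! ### Pure contractions and block eliminations -/

section Contraction

variable {P Q : BlockPattern} {s m k e i j : ℕ} {K : Type*} [CommRing K] {T : Set ℕ}

/-- The part of `x` with rows and columns from `m` on. -/
def truncate (m : ℕ) (x : Matrix ℕ ℕ K) : Matrix ℕ ℕ K :=
  Matrix.of fun i j => if m ≤ i ∧ m ≤ j then x i j else 0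

theorem truncate_apply (x : Matrix ℕ ℕ K) (hi : m ≤ i) (hj : m ≤ j) : truncate m x i j = x i j :=
  if_pos ⟨hi, hj⟩

theorem arcRow_contraction (hmk : m ≤ k) (hke : k ≤ e) (hlen : s + e = m + k) (hj : m ≤ j)
    (x : Matrix ℕ ℕ K) :
    arcRow ((P.cons k e).cons m k) Q x j i = arcRow (P.cons s e) (Q.cons s m) x j i +
      if j ∈ Set.Ico k e ∧ j < k + e - 1 - j then x (k + e - 1 - j) i else 0 := by
  simp only [arcRow, cons_mirror_of_le hj, Set.mem_Ico]
  rcases lt_or_ge j k with hjk | hkj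
  · rw [cons_mirror_of_mem hj hjk, cons_mirror_of_mem (by omega) (by omega), ← hlen,
      if_neg (by omega : ¬ (_ ∧ _)), add_zero]
  · rw [cons_mirror_of_le hkj]
    rcases lt_or_ge j e with hje | hej
    · rw [cons_mirror_of_mem hkj hje, cons_mirror_of_mem (by omega) hje,
        if_neg (by omega : ¬ j < s + e - 1 - j), zero_add, add_comm]
      simp only [hkj, hje, true_and]
    · rw [cons_mirror_of_le hej, cons_mirror_of_le hej, if_neg (by omega : ¬ (_ ∧ _)), add_zero]

theorem arcRow_contraction_swap (hmk : m ≤ k) (hke : k ≤ e) (hlen : s + e = m + k) (hi : m ≤ i)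
    (x : Matrix ℕ ℕ K) :
    arcRow Q ((P.cons k e).cons m k) x i j = arcRow (Q.cons s m) (P.cons s e) x i j +
      if i ∈ Set.Ico k e then
        (if k + e - 1 - i < i then x (k + e - 1 - i) j else 0) - x (s + e - 1 - i) j
      else 0 := by
  simp only [arcRow, cons_mirror_of_le hi, Set.mem_Ico]
  rcases lt_or_ge i k with hik | hki
  · rw [cons_mirror_of_mem hi hik, cons_mirror_of_mem (by omega) (by omega), ← hlen,
      if_neg (by omega : ¬ (_ ∧ _)), add_zero]
  · rw [cons_mirror_of_le hki]
    rcases lt_or_ge i e with hie | hei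
    · rw [cons_mirror_of_mem hki hie, cons_mirror_of_mem (by omega) hie,
        if_pos (by omega : s + e - 1 - i < i), if_pos (⟨hki, hie⟩ : _ ∧ _)]
      ring
    · rw [cons_mirror_of_le hei, cons_mirror_of_le hei, if_neg (by omega : ¬ (_ ∧ _)), add_zero]

theorem Allowed.of_contraction (h : Allowed ((P.cons k e).cons m k) Q i j) (hsm : s ≤ m)
    (hmk : m ≤ k) (hke : k ≤ e) : Allowed (P.cons s e) (Q.cons s m) i j := by
  rcases h with ⟨hji, h | h | h⟩ | ⟨hij, h⟩
  · exact allowed_of_le hji (hsm.trans h.2.1) (h.1.2.trans_le hke)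
  · exact allowed_of_le hji ((hsm.trans hmk).trans h.2.1) h.1.2
  · exact Or.inl ⟨hji, Or.inr h⟩
  · exact Or.inr ⟨hij, Or.inr h⟩

namespace IsKernelPair

variable {x S : Matrix ℕ ℕ K} (h : IsKernelPair (P.cons s e) (Q.cons s m) T x S)
include h

theorem apply_of_contraction (hmk : m ≤ k) (hlen : s + e = m + k) (hQ : Q.StartsAt m)
    (hT : T ⊆ Set.Ici m) (hj : k ≤ j) (hj' : j < e) (hi : m ≤ i) (hi' : i < e) :
    x j i = if k ≤ i then x (s + e - 1 - j) (s + e - 1 - i) else 0 := by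
  have hK := h.intertwine hQ hT (j := s + e - 1 - j) (by omega) (by omega) hi hi'
  rw [show s + e - 1 - (s + e - 1 - j) = j by omega, if_pos (by omega)] at hK
  rw [hK]
  split_ifs with hlt hki hki
  · rfl
  · exact h.apply_eq_zero_of_lt_of_le hQ (by omega) (by omega)
  · omega
  · rfl

theorem apply_reflect_of_contraction (hmk : m ≤ k) (hke : k ≤ e) (hlen : s + e = m + k)
    (hQ : Q.StartsAt m) (hT : T ⊆ Set.Ici m) (hj : k ≤ j) (hj' : j < e) (hi : k ≤ i)
    (hi' : i < e) :
    x j (s + e - 1 - i) = (if k + e - 1 - i < i then x j (k + e - 1 - i) else 0) -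
      if j < k + e - 1 - j then x (k + e - 1 - j) i else 0 := by
  have hI := h.square (hmk.trans hke) hT (i := s + e - 1 - i) (j := s + e - 1 - j)
    (by omega) (by omega) (by omega) (by omega)
  have hcol := h.apply_of_contraction hmk hlen hQ hT hj hj' (i := k + e - 1 - i) (by omega)
    (by omega)
  have hrow := h.apply_of_contraction hmk hlen hQ hT (j := k + e - 1 - j) (by omega) (by omega)
    (hmk.trans hi) hi'
  rw [if_pos (by omega)] at hcol hrow
  rw [show s + e - 1 - (s + e - 1 - i) = i by omega, show s + e - 1 - (s + e - 1 - j) = j by omega,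
    show s + m - 1 - (s + e - 1 - i) = s + e - 1 - (k + e - 1 - i) by omega,
    show s + m - 1 - (s + e - 1 - j) = s + e - 1 - (k + e - 1 - j) by omega, ← hcol, ← hrow,
    if_pos (by omega : s + e - 1 - j < j), if_neg (by omega : ¬ i < s + e - 1 - i)] at hI
  rw [← if_congr (by omega : s + e - 1 - i < s + e - 1 - (k + e - 1 - i) ↔ k + e - 1 - i < i) rfl
    rfl, ← if_congr (by omega : s + e - 1 - (k + e - 1 - j) < s + e - 1 - j ↔ j < k + e - 1 - j)
    rfl rfl]
  linear_combination hI

theorem correction_of_contraction (hmk : m ≤ k) (hke : k ≤ e) (hlen : s + e = m + k)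
    (hP : P.StartsAt e) (hQ : Q.StartsAt m) (hT : T ⊆ Set.Ici m) (hi : m ≤ i)
    (hij : Allowed ((P.cons k e).cons m k) Q i j) :
    (if j ∈ Set.Ico k e ∧ j < k + e - 1 - j then x (k + e - 1 - j) i else 0) =
      if i ∈ Set.Ico k e then
        (if k + e - 1 - i < i then x j (k + e - 1 - i) else 0) - x j (s + e - 1 - i) else 0 := by
  have hkj : i ∈ Set.Ico k e → k ≤ j := fun hie => by
    rcases hij with ⟨-, h | h | h⟩ | ⟨h, -⟩
    exacts [absurd h.1.2 hie.1.not_gt, h.2.1, absurd (hP.le_left h) hie.2.not_ge, hie.1.trans h]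
  have hie : j < e → i < e := fun hj => by
    rcases hij with ⟨-, h | h | h⟩ | ⟨h, -⟩
    exacts [h.1.2.trans_le hke, h.1.2, absurd (hP.le_right h) hj.not_ge, h.trans_lt hj]
  by_cases hiL : i ∈ Set.Ico k e
  · rw [if_pos hiL]
    rcases lt_or_ge j e with hje | hej
    · rw [h.apply_reflect_of_contraction hmk hke hlen hQ hT (hkj hiL) hje hiL.1 hiL.2]
      simp only [Set.mem_Ico, hkj hiL, hje, and_self, true_and, sub_sub_cancel]
    · have hzero : ∀ l < e, x j l = 0 := fun l => h.apply_eq_zero_of_le_of_lt hP hej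
      obtain ⟨hki, hie⟩ := hiL
      rw [hzero _ (by omega), hzero _ (by omega), ite_self, sub_zero,
        if_neg fun hj => hej.not_gt hj.1.2]
  · rw [if_neg hiL, ite_eq_right_iff]
    rintro ⟨⟨hkj, hje⟩, -⟩
    have hik : i < k := lt_of_not_ge fun hki => hiL ⟨hki, hie hje⟩
    rw [h.apply_of_contraction hmk hlen hQ hT (by omega) (by omega) hi (hie hje),
      if_neg hik.not_ge]

theorem arcBracket_contraction (hsm : s ≤ m) (hmk : m ≤ k) (hke : k ≤ e) (hlen : s + e = m + k)
    (hP : P.StartsAt e) (hQ : Q.StartsAt m) (hT : T ⊆ Set.Ici m)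
    (hij : Allowed ((P.cons k e).cons m k) Q i j) :
    arcBracket ((P.cons k e).cons m k) Q x j i = S j i := by
  have hC := (hP.cons hke).cons hmk
  have hi : m ≤ i := by
    rcases hij with ⟨-, hij⟩ | ⟨-, hij⟩
    exacts [hC.le_left hij, hQ.le_left hij]
  have hj : m ≤ j := by
    rcases hij with ⟨-, hij⟩ | ⟨-, hij⟩
    exacts [hC.le_right hij, hQ.le_right hij]
  rw [← h.bracket (hij.of_contraction hsm hmk hke), arcBracket, arcBracket,
    arcRow_contraction hmk hke hlen hj, arcRow_contraction_swap hmk hke hlen hi,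
    h.correction_of_contraction hmk hke hlen hP hQ hT hi hij]
  exact add_sub_add_right_eq_sub _ _ _

theorem contraction (hsm : s ≤ m) (hmk : m ≤ k) (hke : k ≤ e) (hlen : s + e = m + k)
    (hP : P.StartsAt e) (hQ : Q.StartsAt m) (hT : T ⊆ Set.Ici m) :
    IsKernelPair ((P.cons k e).cons m k) Q T (truncate m x) S where
  support {i j} hij := by
    by_cases hm : m ≤ i ∧ m ≤ j
    swap
    · exact if_neg hm
    rw [truncate_apply x hm.1 hm.2]
    by_cases hcorner : k ≤ i ∧ i < e ∧ j < k
    · rw [h.apply_of_contraction hmk hlen hQ hT hcorner.1 hcorner.2.1 hm.2 (by omega),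
        if_neg (by omega)]
    · refine h.support fun hold => hij ?_
      rcases hold with ⟨hji, hr | hr⟩ | ⟨hij', hr | hr⟩
      · simp only [Set.mem_Ico] at hr
        rcases lt_or_ge i k with hik | hki
        · exact allowed_of_le hji hm.2 hik
        · exact Or.inl ⟨hji, Or.inr (Or.inl ⟨⟨hki, hr.1.2⟩, by omega, hr.2.2⟩)⟩
      · exact Or.inl ⟨hji, Or.inr (Or.inr hr)⟩
      · exact absurd hr.1.2 hm.1.not_gt
      · exact Or.inr ⟨hij', hr⟩
  skew hi hj := by
    rw [truncate_apply x (hT hi) (hT hj), truncate_apply x (hT hj) (hT hi), h.skew hi hj]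
  isSymm := h.isSymm
  eq_zero_off := h.eq_zero_off
  bracket {i j} hij := by
    have hC := (hP.cons hke).cons hmk
    have hmi : m ≤ i ∧ m ≤ j := by
      rcases hij with ⟨-, hij⟩ | ⟨-, hij⟩
      exacts [⟨hC.le_left hij, hC.le_right hij⟩, ⟨hQ.le_left hij, hQ.le_right hij⟩]
    rw [← h.arcBracket_contraction hsm hmk hke hlen hP hQ hT hij]
    exact arcBracket_congr hC.mapsTo hQ.mapsTo (fun _ hl _ hp => truncate_apply x hl hp) hmi.1
      hmi.2

theorem eq_zero_of_contraction (hsm : s ≤ m) (hmk : m ≤ k) (hke : k ≤ e) (hlen : s + e = m + k)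
    (hP : P.StartsAt e) (hQ : Q.StartsAt m) (hT : T ⊆ Set.Ici m) (hx : truncate m x = 0)
    (hS : S = 0) : x = 0 := by
  have hge {i j : ℕ} (hi : m ≤ i) (hj : m ≤ j) : x i j = 0 := by
    rw [← truncate_apply x hi hj, hx, Matrix.zero_apply]
  ext i j
  rw [Matrix.zero_apply]
  rcases le_or_gt m j with hmj | hjm
  · rcases le_or_gt m i with hmi | him
    · exact hge hmi hmj
    · exact h.apply_eq_zero_of_lt_of_le hQ him hmj
  by_cases hs : i < s ∨ j < s
  · exact h.apply_eq_zero_of_lt (hsm.trans (hmk.trans hke)) hsm hP hQ hs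
  rcases le_or_gt e i with hei | hie
  · exact h.apply_eq_zero_of_le_of_lt hP hei (by omega)
  rcases lt_or_ge i m with him | hmi
  · have hK := h.apply_of_contraction hmk hlen hQ hT (j := s + e - 1 - i) (i := s + e - 1 - j)
      (by omega) (by omega) (by omega) (by omega)
    rw [hge (by omega) (by omega), if_pos (by omega)] at hK
    rw [show i = s + e - 1 - (s + e - 1 - i) by omega, ← hK.symm,
      show s + e - 1 - (s + e - 1 - j) = j by omega]
  rcases lt_or_ge i k with hik | hki
  · have hE := h.bracket (i := s + e - 1 - j) (j := i)
      (allowed_of_le (by omega) (by omega) (by omega))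
    simp only [arcBracket, arcRow, Matrix.transpose_apply, hS, Matrix.zero_apply] at hE
    rw [cons_mirror_of_le hmi, cons_mirror_of_le (by omega : m ≤ s + e - 1 - j),
      cons_mirror_of_mem (by omega) hie, cons_mirror_of_mem (by omega) (by omega),
      show s + e - 1 - (s + e - 1 - j) = j by omega, hge (by omega) (by omega),
      hge (hQ.mono hmi) (by omega), hge hmi (hQ.mono (by omega)),
      if_pos (by omega : j < s + e - 1 - j)] at hE
    simpa using hE
  · have hI := h.apply_reflect_of_contraction hmk hke hlen hQ hT hki hie
      (i := s + e - 1 - j) (by omega) (by omega)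
    rwa [show s + e - 1 - (s + e - 1 - j) = j by omega,
      hge hmi (by omega : m ≤ k + e - 1 - (s + e - 1 - j)),
      hge (by omega : m ≤ k + e - 1 - i) (by omega), ite_self, ite_self, sub_zero] at hI

end IsKernelPair

theorem Rigid.contraction (h : Rigid K ((P.cons k e).cons m k) Q T) (hsm : s ≤ m) (hmk : m ≤ k)
    (hke : k ≤ e) (hlen : s + e = m + k) (hP : P.StartsAt e) (hQ : Q.StartsAt m)
    (hT : T ⊆ Set.Ici m) : Rigid K (P.cons s e) (Q.cons s m) T := fun x S hx => by
  obtain ⟨hx0, hS0⟩ := h _ _ (hx.contraction hsm hmk hke hlen hP hQ hT)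
  exact ⟨hx.eq_zero_of_contraction hsm hmk hke hlen hP hQ hT hx0 hS0, hS0⟩

end Contraction

/-! ### Rotation contractions -/

section Rotation

variable {P Q : BlockPattern} {s d m e i j : ℕ} {K : Type*} [CommRing K] {T : Set ℕ}

/-- The matrix which a rotation contraction produces from `x`: the part of `x` with rows and columns
in `[s, m)` is turned around onto `[d, e)`, where `s + e = d + m`. It takes the place of the part on
`[m, e)`, with which it agrees for a solution `x` of the kernel equations. -/
def rotate (s d m e : ℕ) (x : Matrix ℕ ℕ K) : Matrix ℕ ℕ K :=
  Matrix.of fun i j =>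
    if m ≤ i ∧ m ≤ j then x i j
    else if i ∈ Set.Ico d e ∧ j ∈ Set.Ico d e then x (s + e - 1 - i) (s + e - 1 - j) else 0

theorem rotate_apply_of_le (x : Matrix ℕ ℕ K) (hi : m ≤ i) (hj : m ≤ j) :
    rotate s d m e x i j = x i j :=
  if_pos ⟨hi, hj⟩

theorem rotate_eq_zero (x : Matrix ℕ ℕ K) (hm : i < m ∨ j < m)
    (h : i ∉ Set.Ico d e ∨ j ∉ Set.Ico d e) : rotate s d m e x i j = 0 :=
  (if_neg (by omega)).trans (if_neg (by tauto))

theorem arcRow_rotate (hdm : d ≤ m) (hme : m ≤ e) (hlen : s + e = d + m) (hP : P.StartsAt e)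
    (hQ : Q.StartsAt m) (hj : m ≤ j) (hi : m ≤ i) (x : Matrix ℕ ℕ K) :
    arcRow (P.cons d e) (Q.cons d m) (rotate s d m e x) j i =
      arcRow (P.cons s e) (Q.cons s m) x j i +
        if j < e ∧ j < d + e - 1 - j then rotate s d m e x (d + e - 1 - j) i else 0 := by
  simp only [arcRow, cons_mirror_of_le hj, rotate_apply_of_le x (hQ.mono hj) hi]
  rcases lt_or_ge j e with hje | hej
  · rw [cons_mirror_of_mem (by omega) hje, cons_mirror_of_mem (by omega) hje,
      if_neg (by omega : ¬ j < s + e - 1 - j), zero_add, add_comm]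
    simp only [hje, true_and]
  · have := hP.mono hej
    rw [cons_mirror_of_le hej, cons_mirror_of_le hej, if_neg (by omega : ¬ (_ ∧ _)), add_zero,
      rotate_apply_of_le x (by omega) hi]

theorem arcRow_rotate_swap (hdm : d ≤ m) (hme : m ≤ e) (hlen : s + e = d + m) (hP : P.StartsAt e)
    (hQ : Q.StartsAt m) (hj : m ≤ j) (hi : m ≤ i) (x : Matrix ℕ ℕ K) :
    arcRow (Q.cons d m) (P.cons d e) (rotate s d m e x).transpose i j =
      arcRow (Q.cons s m) (P.cons s e) x.transpose i j +
        if i < e then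
          (if d + e - 1 - i < i then rotate s d m e x j (d + e - 1 - i) else 0) -
            x j (s + e - 1 - i)
        else 0 := by
  simp only [arcRow, cons_mirror_of_le hi, Matrix.transpose_apply,
    rotate_apply_of_le x hj (hQ.mono hi)]
  rcases lt_or_ge i e with hie | hei
  · rw [cons_mirror_of_mem (by omega) hie, cons_mirror_of_mem (by omega) hie,
      if_pos (by omega : s + e - 1 - i < i), if_pos hie]
    ring
  · have := hP.mono hei
    rw [cons_mirror_of_le hei, cons_mirror_of_le hei, if_neg hei.not_gt, add_zero,
      rotate_apply_of_le x hj (by omega)]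

theorem Allowed.of_rotation (h : Allowed (P.cons d e) (Q.cons d m) i j) (hsd : s ≤ d)
    (hi : m ≤ i) : Allowed (P.cons s e) (Q.cons s m) i j := by
  rcases h with ⟨hji, hr | hr⟩ | ⟨hij, hr | hr⟩
  · exact allowed_of_le hji (hsd.trans hr.2.1) hr.1.2
  · exact Or.inl ⟨hji, Or.inr hr⟩
  · exact absurd hr.1.2 hi.not_gt
  · exact Or.inr ⟨hij, Or.inr hr⟩

namespace IsKernelPair

variable {x S : Matrix ℕ ℕ K} (h : IsKernelPair (P.cons s e) (Q.cons s m) T x S)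
include h

theorem apply_of_rotation (hdm : d ≤ m) (hlen : s + e = d + m)
    (hQ : Q.StartsAt m) (hT : T ⊆ Set.Ici m) (hj : d ≤ j) (hj' : j < e) (hi : m ≤ i) (hi' : i < e) :
    x (s + e - 1 - j) (s + e - 1 - i) = if s + e - 1 - j < j then x j i else 0 := by
  have hV := h.intertwine hQ hT (j := s + e - 1 - j) (by omega) (by omega) hi hi'
  rwa [show s + e - 1 - (s + e - 1 - j) = j by omega, if_pos (by omega : s + e - 1 - i < i),
    eq_comm] at hV

theorem rotate_apply_of_mem (hdm : d ≤ m) (hlen : s + e = d + m)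
    (hQ : Q.StartsAt m) (hT : T ⊆ Set.Ici m) (hi : d ≤ i) (hi' : i < e) (hj : d ≤ j) (hj' : j < e) :
    rotate s d m e x i j = x (s + e - 1 - i) (s + e - 1 - j) := by
  by_cases hm : m ≤ i ∧ m ≤ j
  · rw [rotate_apply_of_le x hm.1 hm.2,
      h.apply_of_rotation hdm hlen hQ hT hi hi' hm.2 hj', if_pos (by omega)]
  · exact (if_neg hm).trans (if_pos ⟨⟨hi, hi'⟩, hj, hj'⟩)

theorem apply_eq_zero_of_rotation (hsd : s ≤ d) (hdm : d ≤ m) (hlen : s + e = d + m)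
    (hP : P.StartsAt e) (hQ : Q.StartsAt m) (hT : T ⊆ Set.Ici m)
    (hi : d ≤ i) (hi' : i < m) (hj : j < d) : x i j = 0 := by
  by_cases hjs : j < s
  · exact h.apply_eq_zero_of_lt (by omega) (by omega) hP hQ (Or.inr hjs)
  · have hV := h.apply_of_rotation hdm hlen hQ hT (j := s + e - 1 - i) (i := s + e - 1 - j)
      (by omega) (by omega) (by omega) (by omega)
    rwa [h.apply_eq_zero_of_lt_of_le hQ (i := s + e - 1 - i) (j := s + e - 1 - j)
      (by omega) (by omega), ite_self, show s + e - 1 - (s + e - 1 - i) = i by omega,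
      show s + e - 1 - (s + e - 1 - j) = j by omega] at hV

theorem square_rotate (hsd : s ≤ d) (hdm : d ≤ m) (hme : m ≤ e) (hlen : s + e = d + m)
    (hQ : Q.StartsAt m) (hT : T ⊆ Set.Ici m) (hi : d ≤ i) (hi' : i < e) (hj : d ≤ j) (hj' : j < e) :
    (if s + e - 1 - j < j then x j (s + e - 1 - i) else 0) +
        (if j < d + e - 1 - j then rotate s d m e x (d + e - 1 - j) i else 0) -
      ((if d + e - 1 - i < i then rotate s d m e x j (d + e - 1 - i) else 0) +
        (if i < s + e - 1 - i then x (s + e - 1 - j) i else 0)) = 0 := by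
  have hI := h.square hme hT (i := s + e - 1 - i) (j := s + e - 1 - j)
    (by omega) (by omega) (by omega) (by omega)
  rw [show s + e - 1 - (s + e - 1 - i) = i by omega, show s + e - 1 - (s + e - 1 - j) = j by omega,
    show s + m - 1 - (s + e - 1 - i) = s + e - 1 - (d + e - 1 - i) by omega,
    show s + m - 1 - (s + e - 1 - j) = s + e - 1 - (d + e - 1 - j) by omega] at hI
  rw [if_congr (by omega : s + e - 1 - i < s + e - 1 - (d + e - 1 - i) ↔ d + e - 1 - i < i) rfl
    rfl, if_congr (by omega : s + e - 1 - (d + e - 1 - j) < s + e - 1 - j ↔ j < d + e - 1 - j)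
    rfl rfl] at hI
  rwa [h.rotate_apply_of_mem hdm hlen hQ hT (by omega) (by omega) hi hi',
    h.rotate_apply_of_mem hdm hlen hQ hT hj hj' (by omega) (by omega)]

theorem arcBracket_rotate_of_le (hsd : s ≤ d) (hdm : d ≤ m) (hme : m ≤ e) (hlen : s + e = d + m)
    (hP : P.StartsAt e) (hQ : Q.StartsAt m) (hT : T ⊆ Set.Ici m) (hi : m ≤ i) (hj : m ≤ j)
    (hij : Allowed (P.cons d e) (Q.cons d m) i j) :
    arcBracket (P.cons d e) (Q.cons d m) (rotate s d m e x) j i = S j i := by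
  rw [← h.bracket (hij.of_rotation hsd hi), arcBracket, arcBracket,
    arcRow_rotate hdm hme hlen hP hQ hj hi, arcRow_rotate_swap hdm hme hlen hP hQ hj hi]
  suffices hcorr : (if j < e ∧ j < d + e - 1 - j then rotate s d m e x (d + e - 1 - j) i else 0) =
      if i < e then
        (if d + e - 1 - i < i then rotate s d m e x j (d + e - 1 - i) else 0) - x j (s + e - 1 - i)
      else 0 by
    rw [hcorr]
    exact add_sub_add_right_eq_sub _ _ _
  have hie : j < e → i < e := fun hj => by
    rcases hij with ⟨-, hr | hr⟩ | ⟨hle, -⟩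
    exacts [hr.1.2, absurd (hP.le_right hr) hj.not_ge, hle.trans_lt hj]
  rcases lt_or_ge j e with hje | hej
  · have hI := h.square_rotate hsd hdm hme hlen hQ hT (by omega) (hie hje) (hdm.trans hj) hje
    rw [if_pos (by omega : s + e - 1 - j < j), if_neg (by omega : ¬ i < s + e - 1 - i)] at hI
    rw [if_pos (hie hje)]
    simp only [hje, true_and]
    linear_combination hI
  · have hzero (l : ℕ) (hl : l < e) : rotate s d m e x j l = 0 := by
      by_cases hlm : m ≤ l
      · rw [rotate_apply_of_le x hj hlm, h.apply_eq_zero_of_le_of_lt hP hej hl]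
      · exact rotate_eq_zero x (by omega) (Or.inl fun hje => hej.not_gt hje.2)
    rw [if_neg (by omega : ¬ (_ ∧ _))]
    split_ifs with hie hlt
    · rw [hzero _ (by omega), h.apply_eq_zero_of_le_of_lt hP hej (by omega), sub_zero]
    · rw [h.apply_eq_zero_of_le_of_lt hP hej (by omega), sub_zero]
    · rfl

theorem arcBracket_rotate_of_lt (hsd : s ≤ d) (hdm : d ≤ m) (hme : m ≤ e) (hlen : s + e = d + m)
    (hP : P.StartsAt e) (hQ : Q.StartsAt m) (hT : T ⊆ Set.Ici m) (hi : d ≤ i) (hi' : i < e)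
    (hj : d ≤ j) (hj' : j < m) :
    arcBracket (P.cons d e) (Q.cons d m) (rotate s d m e x) j i = 0 := by
  rw [← h.square_rotate hsd hdm hme hlen hQ hT hi hi' hj (hj'.trans_le hme)]
  have hQi : (if i < (Q.cons d m).mirror i then rotate s d m e x j ((Q.cons d m).mirror i) else 0) =
      if i < s + e - 1 - i then x (s + e - 1 - j) i else 0 := by
    rcases lt_or_ge i m with him | hmi
    · rw [cons_mirror_of_mem hi him, h.rotate_apply_of_mem hdm hlen hQ hT hj (by omega)
        (by omega) (by omega), show s + e - 1 - (d + m - 1 - i) = i by omega, hlen]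
    · have hQi := hQ.mono hmi
      rw [cons_mirror_of_le hmi, if_neg (by omega : ¬ i < s + e - 1 - i)]
      suffices rotate s d m e x j (Q.mirror i) = 0 by rw [this, ite_self]
      rcases lt_or_ge (Q.mirror i) e with hlt | hle
      · rw [h.rotate_apply_of_mem hdm hlen hQ hT hj (by omega) (by omega) hlt]
        exact h.apply_eq_zero_of_rotation hsd hdm hlen hP hQ hT (by omega) (by omega)
          (by omega)
      · exact rotate_eq_zero x (by omega) (Or.inr fun h => hle.not_gt h.2)
  rw [arcBracket, arcRow, arcRow, Matrix.transpose_apply, Matrix.transpose_apply, hQi,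
    cons_mirror_of_mem hi hi', cons_mirror_of_mem hj (hj'.trans_le hme), cons_mirror_of_mem hj hj',
    h.rotate_apply_of_mem hdm hlen hQ hT (i := d + m - 1 - j) (by omega) (by omega) hi hi',
    show s + e - 1 - (d + m - 1 - j) = j by omega, hlen]
  ring

theorem rotation (hsd : s ≤ d) (hdm : d ≤ m) (hme : m ≤ e) (hlen : s + e = d + m)
    (hP : P.StartsAt e) (hQ : Q.StartsAt m) (hT : T ⊆ Set.Ici m) :
    IsKernelPair (P.cons d e) (Q.cons d m) T (rotate s d m e x) S where
  support {i j} hij := by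
    by_cases hm : m ≤ i ∧ m ≤ j
    · rw [rotate_apply_of_le x hm.1 hm.2]
      refine h.support fun hold => hij ?_
      rcases hold with ⟨hji, hr | hr⟩ | ⟨hij', hr | hr⟩
      · exact allowed_of_le hji (hdm.trans hm.2) hr.1.2
      · exact Or.inl ⟨hji, Or.inr hr⟩
      · exact absurd hr.1.2 hm.1.not_gt
      · exact Or.inr ⟨hij', Or.inr hr⟩
    by_cases hde : i ∈ Set.Ico d e ∧ j ∈ Set.Ico d e
    · obtain ⟨⟨hi, hi'⟩, hj, hj'⟩ := hde
      rw [h.rotate_apply_of_mem hdm hlen hQ hT hi hi' hj hj']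
      have hlt : i < j := lt_of_not_ge fun hji => hij (allowed_of_le hji hj hi')
      have hmj : m ≤ j := le_of_not_gt fun hjm =>
        hij (allowed_of_mem_Ico hme hi (hlt.trans hjm) hj hjm)
      exact h.apply_eq_zero_of_rotation hsd hdm hlen hP hQ hT (by omega) (by omega) (by omega)
    · exact rotate_eq_zero x (by omega) (not_and_or.1 hde)
  skew hi hj := by
    rw [rotate_apply_of_le x (hT hi) (hT hj), rotate_apply_of_le x (hT hj) (hT hi), h.skew hi hj]
  isSymm := h.isSymm
  eq_zero_off := h.eq_zero_off
  bracket {i j} hij := by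
    rcases lt_or_ge j m with hjm | hmj
    · have hje := hjm.trans_le hme
      have hi : d ≤ i ∧ d ≤ j ∧ i < e := by
        rcases hij with ⟨-, hr | hr⟩ | ⟨hle, hr | hr⟩
        exacts [⟨hr.1.1, hr.2.1, hr.1.2⟩, absurd (hP.le_right hr) hje.not_ge,
          ⟨hr.1.1, hr.2.1, hle.trans_lt hje⟩, absurd (hQ.le_right hr) hjm.not_ge]
      rw [h.eq_zero_off fun hji => (hT hji.1).not_gt hjm]
      exact h.arcBracket_rotate_of_lt hsd hdm hme hlen hP hQ hT hi.1 hi.2.2 hi.2.1 hjm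
    · have hmi : m ≤ i := by
        rcases hij with ⟨hle, -⟩ | ⟨-, hr | hr⟩
        exacts [hmj.trans hle, absurd hr.2.2 hmj.not_gt, hQ.le_left hr]
      exact h.arcBracket_rotate_of_le hsd hdm hme hlen hP hQ hT hmi hmj hij

theorem eq_zero_of_rotation (hsd : s ≤ d) (hdm : d ≤ m) (hme : m ≤ e) (hlen : s + e = d + m)
    (hP : P.StartsAt e) (hQ : Q.StartsAt m) (hT : T ⊆ Set.Ici m) (hx : rotate s d m e x = 0) :
    x = 0 := by
  have htop {i j : ℕ} (hi : i < m) : x i j = 0 := by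
    rcases le_or_gt m j with hmj | hjm
    · exact h.apply_eq_zero_of_lt_of_le hQ hi hmj
    by_cases hs : i < s ∨ j < s
    · exact h.apply_eq_zero_of_lt (by omega) (by omega) hP hQ hs
    have hK := h.rotate_apply_of_mem hdm hlen hQ hT (i := s + e - 1 - i) (j := s + e - 1 - j)
      (by omega) (by omega) (by omega) (by omega)
    rwa [hx, Matrix.zero_apply, show s + e - 1 - (s + e - 1 - i) = i by omega,
      show s + e - 1 - (s + e - 1 - j) = j by omega, eq_comm] at hK
  ext i j
  rw [Matrix.zero_apply]
  rcases lt_or_ge i m with him | hmi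
  · exact htop him
  rcases le_or_gt m j with hmj | hjm
  · rw [← rotate_apply_of_le (s := s) (d := d) (e := e) x hmi hmj, hx, Matrix.zero_apply]
  rcases lt_or_ge j s with hjs | hsj
  · exact h.apply_eq_zero_of_lt (by omega) (by omega) hP hQ (Or.inr hjs)
  rcases le_or_gt e i with hei | hie
  · exact h.apply_eq_zero_of_le_of_lt hP hei (by omega)
  have hI := h.square hme hT (i := j) (j := s + e - 1 - i) hsj hjm (by omega) (by omega)
  rw [show s + e - 1 - (s + e - 1 - i) = i by omega, if_pos (by omega : s + e - 1 - i < i),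
    htop (i := s + m - 1 - (s + e - 1 - i)) (by omega), htop (i := s + e - 1 - i) (by omega),
    htop (i := s + e - 1 - i) (by omega)] at hI
  simpa using hI

end IsKernelPair

theorem Rigid.rotation (h : Rigid K (P.cons d e) (Q.cons d m) T) (hsd : s ≤ d) (hdm : d ≤ m)
    (hme : m ≤ e) (hlen : s + e = d + m) (hP : P.StartsAt e) (hQ : Q.StartsAt m)
    (hT : T ⊆ Set.Ici m) : Rigid K (P.cons s e) (Q.cons s m) T := fun x S hx => by
  obtain ⟨hx0, hS0⟩ := h _ _ (hx.rotation hsd hdm hme hlen hP hQ hT)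
  exact ⟨hx.eq_zero_of_rotation hsd hdm hme hlen hP hQ hT hx0, hS0⟩

end Rotation

/-! ### Rigidity along the winding-down moves -/

section OfList

variable {M N s x i j q : ℕ} {l a b : List ℕ}

/-- The pattern of consecutive blocks of sizes `l` starting at `s`, completed by a last block
without arcs which reaches up to `N`. -/
def ofList (N : ℕ) : List ℕ → ℕ → BlockPattern
  | [], s => ⟨fun i j => i ∈ Set.Ico s N ∧ j ∈ Set.Ico s N, id, And.symm⟩
  | x :: l, s => (ofList N l (s + x)).cons s (s + x)

theorem startsAt_ofList (N : ℕ) (l : List ℕ) (s : ℕ) : (ofList N l s).StartsAt s := by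
  induction l generalizing s with
  | nil => exact ⟨fun h => h.1.1, Set.mapsTo_id _⟩
  | cons x l ih => exact (ih (s + x)).cons (Nat.le_add_right s x)

theorem ofList_rel_lt (hN : s + l.sum ≤ N) (h : (ofList N l s).rel i j) : i < N := by
  induction l generalizing s with
  | nil => exact h.1.2
  | cons x l ih =>
    rw [List.sum_cons] at hN
    rcases h with h | h
    · exact h.1.2.trans_le (by omega)
    · exact ih (by omega) h

theorem ofList_mirror_of_lt (h : i < s) : (ofList N l s).mirror i = i := by
  induction l generalizing s with
  | nil => rfl
  | cons x l ih => exact (cons_mirror_of_lt h).trans (ih (by omega))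

theorem ofList_mirror_of_sum_le (h : s + l.sum ≤ i) : (ofList N l s).mirror i = i := by
  induction l generalizing s with
  | nil => rfl
  | cons x l ih =>
    rw [List.sum_cons] at h
    exact (cons_mirror_of_le (by omega)).trans (ih (by omega))

theorem ofList_mirror_involutive (N : ℕ) (l : List ℕ) (s : ℕ) :
    Function.Involutive (ofList N l s).mirror := by
  induction l generalizing s with
  | nil => exact fun _ => rfl
  | cons x l ih =>
    intro i
    rw [ofList]
    rcases lt_or_ge i s with his | hsi
    · have hl := ofList_mirror_of_lt (N := N) (l := l) (his.trans_le (Nat.le_add_right s x))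
      rw [cons_mirror_of_lt his, hl, cons_mirror_of_lt his, hl]
    rcases lt_or_ge i (s + x) with hix | hxi
    · rw [cons_mirror_of_mem hsi hix, cons_mirror_of_mem (by omega) (by omega)]
      omega
    · rw [cons_mirror_of_le hxi, cons_mirror_of_le ((startsAt_ofList N l (s + x)).mono hxi), ih]

theorem mapsTo_ofList_mirror_Iio (h : s + l.sum ≤ M) :
    Set.MapsTo (ofList N l s).mirror (Set.Iio M) (Set.Iio M) := by
  intro i hi
  by_contra hlt
  have hfix := ofList_mirror_of_sum_le (N := N) (h.trans (not_lt.1 hlt))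
  rw [ofList_mirror_involutive] at hfix
  exact hlt (hfix ▸ hi)

theorem ofList_rel_congr (hi : i < N ↔ i < M) (hj : j < N ↔ j < M) :
    (ofList N l s).rel i j ↔ (ofList M l s).rel i j := by
  induction l generalizing s with
  | nil => simp only [ofList, Set.mem_Ico, hi, hj]
  | cons x l ih => exact or_congr_right ih

theorem ofList_rel_of_sum_le (h : s + l.sum ≤ i) :
    (ofList N l s).rel i j ↔ i < N ∧ s + l.sum ≤ j ∧ j < N := by
  induction l generalizing s with
  | nil =>
    rw [List.sum_nil] at h
    simp only [ofList, List.sum_nil, Set.mem_Ico]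
    omega
  | cons x l ih =>
    rw [List.sum_cons] at h ⊢
    rw [ofList, cons_rel, ih (by omega)]
    omega

theorem eq_of_ofList_replicate_one_rel (h : (ofList (s + q) (List.replicate q 1) s).rel i j) :
    i = j := by
  induction q generalizing s with
  | zero => exact absurd (h.1.1.trans_lt h.1.2) (lt_irrefl s)
  | succ q ih =>
    rw [List.replicate_succ, ofList, cons_rel] at h
    rcases h with h | h
    · omega
    · exact ih (s := s + 1) (by rwa [add_right_comm, add_assoc])

variable {K : Type*} [CommRing K]

theorem IsKernelPair.eq_zero_of_replicate_one [IsAddTorsionFree K] {q : ℕ} {x S : Matrix ℕ ℕ K}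
    (h : IsKernelPair (ofList (s + q) (List.replicate q 1) s) (ofList (s + q) [] s)
      (Set.Ico s (s + q)) x S) : x = 0 := by
  ext i j
  rw [Matrix.zero_apply]
  by_cases hij : i ∈ Set.Ico s (s + q) ∧ j ∈ Set.Ico s (s + q)
  swap
  · refine h.support ?_
    rintro (⟨-, hr⟩ | ⟨-, hr⟩)
    · have hj := (ofList _ _ s).symm hr
      have hs := startsAt_ofList (s + q) (List.replicate q 1) s
      exact hij ⟨⟨hs.le_left hr, ofList_rel_lt (by simp) hr⟩, hs.le_left hj,
        ofList_rel_lt (by simp) hj⟩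
    · exact hij hr
  have hlow {i j : ℕ} (hji : j < i) : x i j = 0 := by
    refine h.support ?_
    rintro (⟨-, hr⟩ | ⟨hle, -⟩)
    · exact hji.ne' (eq_of_ofList_replicate_one_rel hr)
    · exact hle.not_gt hji
  have hskew := h.skew hij.1 hij.2
  rcases lt_trichotomy i j with hlt | rfl | hlt
  · rw [hskew, hlow hlt, neg_zero]
  · exact self_eq_neg.1 hskew
  · exact hlow hlt

theorem rigid_replicate_one [IsAddTorsionFree K] (s q : ℕ) :
    Rigid K (ofList (s + q) (List.replicate q 1) s) (ofList (s + q) [] s) (Set.Ico s (s + q)) := by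
  intro x S h
  have hx := h.eq_zero_of_replicate_one
  refine ⟨hx, ?_⟩
  have hS {i j : ℕ} (hij : i ≤ j) : S j i = 0 := by
    by_cases hT : j ∈ Set.Ico s (s + q) ∧ i ∈ Set.Ico s (s + q)
    · rw [← h.bracket (Or.inr ⟨hij, hT.2, hT.1⟩), hx]
      simp [arcBracket, arcRow]
    · exact h.eq_zero_off hT
  ext i j
  rcases le_total i j with hij | hji
  · rw [h.isSymm.apply, hS hij, Matrix.zero_apply]
  · rw [hS hji, Matrix.zero_apply]

end OfList

end BlockPattern

open BlockPattern

theorem HomotopyTypeC.sum_add_one_eq {n q : ℕ} {a b : List ℕ}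
    (h : HomotopyTypeC n a b [] (List.replicate q 1) 2) (ha : a.sum ≤ n) (hb : b.sum ≤ n) :
    (a.sum + 1 = n ∧ b.sum + q + 1 = n) ∨ (b.sum + 1 = n ∧ a.sum + q + 1 = n) := by
  generalize hD : [] = D, hc : List.replicate q 1 = c, hr : 2 = r at h
  induction h with
  | doneBot n c | doneTop n c =>
    subst hc
    simp only [List.sum_replicate, List.sum_nil, smul_eq_mul, mul_one] at *
    omega
  | pureContraction h _ ih | blockElimination h _ ih | rotationContraction h _ _ ih =>
    have := ih (hD := hD) (hc := hc) (hr := hr)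
    simp only [List.sum_cons] at *
    omega
  | componentDeletion => simp at hD
  | flip _ _ ih => exact (ih hb ha hD hc hr).symm

theorem HomotopyTypeC.rigid {K : Type*} [CommRing K] [IsAddTorsionFree K] {n q s N : ℕ}
    {a b : List ℕ} (h : HomotopyTypeC n a b [] (List.replicate q 1) 2) (ha : a.sum ≤ n)
    (hb : b.sum ≤ n) (hN : N + 1 = s + n) :
    Rigid K (ofList N a s) (ofList N b s) (Set.Ico (N - q) N) := by
  have hsums := h.sum_add_one_eq ha hb
  generalize hD : [] = D, hc : List.replicate q 1 = c, hr : 2 = r at h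
  induction h generalizing s with
  | doneBot n c =>
    subst hc
    simp only [List.sum_replicate, smul_eq_mul, mul_one] at hr
    obtain rfl : N = s + q := by omega
    rw [Nat.add_sub_cancel]
    exact rigid_replicate_one s q
  | doneTop n c =>
    subst hc
    simp only [List.sum_replicate, smul_eq_mul, mul_one] at hr
    obtain rfl : N = s + q := by omega
    rw [Nat.add_sub_cancel]
    exact (rigid_replicate_one s q).flip
  | @pureContraction n x y a b D c r hlt _ ih =>
    simp only [List.sum_cons] at ha hb hsums ih
    have hrigid := ih (s := s + y) (by omega) (by omega) (by omega) (by omega) hD hc hr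
    simp only [ofList, show s + y + (x - 2 * y) + y = s + x by omega] at hrigid ⊢
    exact hrigid.contraction (by omega) (by omega) (by omega) (by omega) (startsAt_ofList _ _ _)
      (startsAt_ofList _ _ _) fun i hi => (by omega : s + y ≤ N - q).trans hi.1
  | @blockElimination n x y a b D c r heq _ ih =>
    simp only [List.sum_cons] at ha hb hsums ih
    have hrigid := ih (s := s + y) (by omega) (by omega) (by omega) (by omega) hD hc hr
    simp only [ofList, show s + y + y = s + x by omega] at hrigid ⊢
    rw [← cons_self (s + y) (cons _ _ _)] at hrigid
    exact hrigid.contraction (by omega) le_rfl (by omega) (by omega) (startsAt_ofList _ _ _)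
      (startsAt_ofList _ _ _) fun i hi => (by omega : s + y ≤ N - q).trans hi.1
  | @rotationContraction n x y a b D c r hlt hlt' _ ih =>
    simp only [List.sum_cons] at ha hb hsums ih
    have hrigid := ih (s := s + (x - y)) (by omega) (by omega) (by omega) (by omega) hD hc hr
    simp only [ofList, show s + (x - y) + y = s + x by omega,
      show s + (x - y) + (2 * y - x) = s + y by omega] at hrigid ⊢
    exact hrigid.rotation (by omega) (by omega) (by omega) (by omega) (startsAt_ofList _ _ _)
      (startsAt_ofList _ _ _) fun i hi => (by omega : s + y ≤ N - q).trans hi.1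
  | componentDeletion => simp at hD
  | flip _ _ ih => exact (ih hb ha hN hsums.symm hD hc hr).flip

/-! ### The full composition and the seaweed -/

section FullComposition

variable {n x M s i j k : ℕ} {a c l : List ℕ}

theorem inBlock_zero_cons : InBlock (x :: l) 0 i ↔ i < x := by
  simp [InBlock]

theorem inBlock_succ_cons : InBlock (x :: l) (k + 1) i ↔ x ≤ i ∧ InBlock l k (i - x) := by
  simp only [InBlock, List.take_succ_cons, List.sum_cons]
  omega

theorem sameBlock_cons :
    SameBlock (x :: l) i j ↔ (i < x ∧ j < x) ∨ (x ≤ i ∧ x ≤ j ∧ SameBlock l (i - x) (j - x)) := by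
  constructor
  · rintro ⟨_ | k, hi, hj⟩
    · exact Or.inl ⟨inBlock_zero_cons.1 hi, inBlock_zero_cons.1 hj⟩
    · rw [inBlock_succ_cons] at hi hj
      exact Or.inr ⟨hi.1, hj.1, k, hi.2, hj.2⟩
  · rintro (⟨hi, hj⟩ | ⟨hi, hj, k, hki, hkj⟩)
    · exact ⟨0, inBlock_zero_cons.2 hi, inBlock_zero_cons.2 hj⟩
    · exact ⟨k + 1, inBlock_succ_cons.2 ⟨hi, hki⟩, inBlock_succ_cons.2 ⟨hj, hkj⟩⟩

theorem isArc_cons :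
    IsArc (x :: l) i j ↔ (i ≠ j ∧ i < x ∧ j < x ∧ i + j + 1 = x) ∨
      (x ≤ i ∧ x ≤ j ∧ IsArc l (i - x) (j - x)) := by
  constructor
  · rintro ⟨hne, _ | k, hi, hj, hsum⟩
    · exact Or.inl ⟨hne, inBlock_zero_cons.1 hi, inBlock_zero_cons.1 hj, by simpa using hsum⟩
    · rw [inBlock_succ_cons] at hi hj
      simp only [List.take_succ_cons, List.sum_cons] at hsum
      exact Or.inr ⟨hi.1, hj.1, by omega, k, hi.2, hj.2, by omega⟩
  · rintro (⟨hne, hi, hj, hsum⟩ | ⟨hi, hj, hne, k, hki, hkj, hsum⟩)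
    · exact ⟨hne, 0, inBlock_zero_cons.2 hi, inBlock_zero_cons.2 hj, by simpa using hsum⟩
    · refine ⟨by omega, k + 1, inBlock_succ_cons.2 ⟨hi, hki⟩, inBlock_succ_cons.2 ⟨hj, hkj⟩, ?_⟩
      simp only [List.take_succ_cons, List.sum_cons]
      omega

theorem sameBlock_append_cons (hi : s ≤ i) (hi' : i < s + a.sum + M) (hj : s ≤ j) :
    SameBlock (a ++ M :: c) (i - s) (j - s) ↔ (ofList (s + a.sum + M) a s).rel i j := by
  induction a generalizing s with
  | nil =>
    simp only [List.sum_nil] at hi'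
    simp only [List.nil_append, sameBlock_cons, ofList, List.sum_nil, Set.mem_Ico]
    omega
  | cons x a ih =>
    rw [List.sum_cons] at hi' ⊢
    rw [List.cons_append, sameBlock_cons, ofList, cons_rel]
    by_cases h : s + x ≤ i ∧ s + x ≤ j
    · rw [or_iff_right (by omega), or_iff_right (by omega), and_iff_right (by omega),
        and_iff_right (by omega), Nat.sub_sub, Nat.sub_sub, ih h.1 (by omega) h.2,
        add_assoc s x a.sum]
    · have hs := startsAt_ofList (s + (x + a.sum) + M) a (s + x)
      rw [or_iff_left (by omega), or_iff_left fun hr => h ⟨hs.le_left hr, hs.le_right hr⟩]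
      omega

theorem isArc_append_cons (hi : s ≤ i) (hi' : i < s + a.sum + M) (hj : s ≤ j) (N : ℕ) :
    IsArc (a ++ M :: c) (i - s) (j - s) ↔ i ≠ j ∧
      ((i < s + a.sum ∧ j = (ofList N a s).mirror i) ∨
        (s + a.sum ≤ i ∧ i + j + 1 = 2 * (s + a.sum) + M)) := by
  induction a generalizing s with
  | nil =>
    simp only [List.sum_nil] at hi'
    simp only [List.nil_append, isArc_cons, List.sum_nil]
    omega
  | cons x a ih =>
    rw [List.sum_cons] at hi' ⊢
    rw [List.cons_append, isArc_cons, ofList]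
    by_cases h : s + x ≤ i
    · rw [cons_mirror_of_le h]
      by_cases h' : s + x ≤ j
      · rw [Nat.sub_sub, Nat.sub_sub, ih h (by omega) h', add_assoc s x a.sum]
        omega
      · have := (startsAt_ofList N a (s + x)).mono h
        omega
    · rw [cons_mirror_of_mem hi (by omega)]
      omega

theorem sameBlock_fullComposition (ha : a.sum ≤ n) (hi : i < 2 * n - a.sum) :
    SameBlock (fullComposition n a) i j ↔ (ofList (2 * n - a.sum) a 0).rel i j := by
  have h := sameBlock_append_cons (a := a) (c := a.reverse) (M := 2 * (n - a.sum)) (j := j)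
    (Nat.zero_le i) (by omega) (Nat.zero_le j)
  rwa [show 0 + a.sum + 2 * (n - a.sum) = 2 * n - a.sum by omega] at h

theorem isArc_fullComposition (ha : a.sum ≤ n) (hi : i < 2 * n - a.sum) (N : ℕ) :
    IsArc (fullComposition n a) i j ↔ i ≠ j ∧ ((i < a.sum ∧ j = (ofList N a 0).mirror i) ∨
      (a.sum ≤ i ∧ i + j + 1 = 2 * n)) := by
  have h := isArc_append_cons (a := a) (c := a.reverse) (M := 2 * (n - a.sum)) (j := j)
    (Nat.zero_le i) (by omega) (Nat.zero_le j) N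
  rwa [show 2 * (0 + a.sum) + 2 * (n - a.sum) = 2 * n by omega, Nat.zero_add] at h

theorem sum_fullComposition (ha : a.sum ≤ n) : (fullComposition n a).sum = 2 * n := by
  simp only [fullComposition, List.sum_append, List.sum_cons, List.sum_reverse]
  omega

theorem reverse_fullComposition (n : ℕ) (a : List ℕ) :
    (fullComposition n a).reverse = fullComposition n a := by
  simp [fullComposition]

theorem InBlock.lt_length (h : InBlock l k i) : k < l.length := by
  by_contra! hk
  obtain ⟨hle, hlt⟩ := h
  rw [List.take_of_length_le (by omega)] at hle hlt
  omega

theorem InBlock.reverse (h : InBlock l k i) :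
    InBlock l.reverse (l.length - 1 - k) (l.sum - 1 - i) := by
  have hk := h.lt_length
  have hsum {m : ℕ} (hm : m ≤ l.length) :
      (l.reverse.take (l.length - m)).sum + (l.take m).sum = l.sum := by
    rw [List.take_reverse, List.sum_reverse, Nat.sub_sub_self hm, add_comm,
      List.sum_take_add_sum_drop]
  have hstart := hsum hk.le
  have hend := hsum (m := k + 1) hk
  obtain ⟨hle, hlt⟩ := h
  rw [InBlock, show l.length - 1 - k + 1 = l.length - k by omega,
    show l.length - 1 - k = l.length - (k + 1) by omega]
  omega

theorem SameBlock.rev (ha : a.sum ≤ n) (h : SameBlock (fullComposition n a) i j) :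
    SameBlock (fullComposition n a) (2 * n - 1 - i) (2 * n - 1 - j) := by
  obtain ⟨k, hi, hj⟩ := h
  have hi := hi.reverse
  have hj := hj.reverse
  rw [reverse_fullComposition, sum_fullComposition ha] at hi hj
  exact ⟨_, hi, hj⟩

end FullComposition

section Seaweed

variable {n i j : ℕ} {a b : List ℕ}

theorem Admissible.rev (ha : a.sum ≤ n) (hb : b.sum ≤ n) (h : Admissible n a b i j) :
    Admissible n a b (2 * n - 1 - j) (2 * n - 1 - i) :=
  h.imp (fun h => ⟨by omega, (h.2.rev ha).symm⟩) fun h => ⟨by omega, (h.2.rev hb).symm⟩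

theorem Admissible.swap (h : Admissible n a b i j) : Admissible n b a j i :=
  (h.imp (And.imp_right SameBlock.symm) (And.imp_right SameBlock.symm)).symm

/-- The sign `ε` of the equations of `𝔰𝔭(2n)`, at the `0`-based position `i`. -/
noncomputable def halfSign (n i : ℕ) : ℂ := if i < n then 1 else -1

theorem halfSign_of_lt (hi : i < n) : halfSign n i = 1 :=
  if_pos hi

theorem halfSign_of_le (hi : n ≤ i) : halfSign n i = -1 :=
  if_neg hi.not_gt

theorem halfSign_mul_self (n i : ℕ) : halfSign n i * halfSign n i = 1 := by
  unfold halfSign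
  split_ifs <;> simp

theorem halfSign_rev (i : Fin (2 * n)) : halfSign n i.rev = -halfSign n i := by
  have := i.2
  simp only [halfSign, Fin.val_rev]
  split_ifs <;> first | omega | simp

theorem antidiagonalJ_apply (i j : Fin (2 * n)) :
    antidiagonalJ n i j = if i = j.rev then halfSign n i else 0 := by
  refine if_congr ?_ rfl rfl
  rw [Fin.ext_iff, Fin.val_rev]
  omega

theorem mem_sp_iff {x : Matrix (Fin (2 * n)) (Fin (2 * n)) ℂ} :
    x ∈ sp n ↔ ∀ i j : Fin (2 * n), x j.rev i.rev = -(halfSign n i * halfSign n j) * x i j := by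
  have hskew : x ∈ sp n ↔ x.transpose * antidiagonalJ n = antidiagonalJ n * (-x) := by
    rw [sp, mem_skewAdjointMatricesLieSubalgebra, mem_skewAdjointMatricesSubmodule]
    rfl
  have hleft (i j : Fin (2 * n)) :
      (x.transpose * antidiagonalJ n) i j = x j.rev i * halfSign n j.rev := by
    simp [Matrix.mul_apply, antidiagonalJ_apply]
  have hright (i j : Fin (2 * n)) :
      (antidiagonalJ n * -x) i j = -(halfSign n i * x i.rev j) := by
    simp [Matrix.mul_apply, antidiagonalJ_apply, ← Fin.rev_eq_iff]
  simp only [hskew, ← Matrix.ext_iff, hleft, hright]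
  rw [← Fin.revPerm.forall_congr_right]
  refine forall₂_congr fun i j => ?_
  rw [Fin.revPerm_apply, Fin.rev_rev, halfSign_rev, halfSign_rev]
  constructor
  · intro h
    linear_combination (-halfSign n j) * h - x j.rev i.rev * halfSign_mul_self n j
  · intro h
    linear_combination (-halfSign n j) * h + halfSign n i * x i j * halfSign_mul_self n j

theorem mem_seaweed_iff {x : Matrix (Fin (2 * n)) (Fin (2 * n)) ℂ} :
    x ∈ seaweed n a b ↔
      (∀ i j : Fin (2 * n), x j.rev i.rev = -(halfSign n i * halfSign n j) * x i j) ∧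
      ∀ i j : Fin (2 * n), ¬ Admissible n a b i j → x i j = 0 := by
  rw [seaweed, LieSubalgebra.mem_inf, mem_sp_iff]
  rfl

theorem single_sub_single_mem_seaweed (ha : a.sum ≤ n) (hb : b.sum ≤ n) {u v : Fin (2 * n)}
    (h : Admissible n a b u v) :
    Matrix.single u v (1 : ℂ) - (halfSign n u * halfSign n v) • Matrix.single v.rev u.rev (1 : ℂ) ∈
      seaweed n a b := by
  rw [mem_seaweed_iff]
  refine ⟨fun i j => ?_, fun i j hij => ?_⟩
  · simp only [Matrix.sub_apply, Matrix.smul_apply, Matrix.single_apply, Fin.rev_inj, smul_eq_mul]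
    have hiff : (u = j.rev ∧ v = i.rev) ↔ (v.rev = i ∧ u.rev = j) := by
      constructor <;> rintro ⟨rfl, rfl⟩ <;> simp
    rw [if_congr hiff rfl rfl, if_congr (and_comm (a := v = j)) rfl rfl]
    by_cases huv : (u = i ∧ v = j) ∨ (v.rev = i ∧ u.rev = j)
    · have hsign : halfSign n i * halfSign n j = halfSign n u * halfSign n v := by
        rcases huv with ⟨rfl, rfl⟩ | ⟨rfl, rfl⟩
        · rfl
        · rw [halfSign_rev, halfSign_rev, neg_mul_neg, mul_comm]
      rw [hsign]
      linear_combination (-if v.rev = i ∧ u.rev = j then (1 : ℂ) else 0) *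
        (halfSign n v * halfSign n v * halfSign_mul_self n u + halfSign_mul_self n v)
    · rw [if_neg (not_or.1 huv).1, if_neg (not_or.1 huv).2]
      simp only [mul_zero, sub_self]
  · have hu : ¬ (u = i ∧ v = j) := by
      rintro ⟨rfl, rfl⟩
      exact hij h
    have hv : ¬ (v.rev = i ∧ u.rev = j) := by
      rintro ⟨rfl, rfl⟩
      refine hij ?_
      convert h.rev ha hb using 1 <;> rw [Fin.val_rev] <;> omega
    simp [hu, hv]

end Seaweed

/-! ### The one-form as a trace form -/

section AftertailForm

variable {n N : ℕ} {a b : List ℕ}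

theorem IsArc.symm {l : List ℕ} {i j : ℕ} (h : IsArc l i j) : IsArc l j i := by
  obtain ⟨hne, k, hi, hj, hsum⟩ := h
  exact ⟨hne.symm, k, hj, hi, by omega⟩

theorem mem_formEdges {p : Fin (2 * n) × Fin (2 * n)} :
    p ∈ formEdges n a b ↔ OrientedFullMeanderEdge n a b p.1 p.2 ∧
      ((p.1 : ℕ) + 1 ≤ n - 1 ∨ (p.2 : ℕ) + 1 ≤ n - 1) := by
  classical
  exact Finset.mem_filter.trans (and_iff_right (Finset.mem_univ _))

theorem swap_mem_formEdges {p : Fin (2 * n) × Fin (2 * n)} (hp : p ∈ formEdges n a b) :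
    p.swap ∈ formEdges n b a := by
  rw [mem_formEdges] at hp ⊢
  exact ⟨(hp.1.imp (And.imp_right IsArc.symm) (And.imp_right IsArc.symm)).symm, hp.2.symm⟩

/-- The position `v` is joined to its mirror image in `0, …, 2N + 1` by an edge of `formEdges`
which lies in the middle block of `a` or of `b`. -/
def IsMiddleArcEnd (N : ℕ) (a b : List ℕ) (v : ℕ) : Prop :=
  (a.sum ≤ v ∧ v < N) ∨ (b.sum ≤ 2 * N + 1 - v ∧ 2 * N + 1 - v < N)

instance : DecidablePred (IsMiddleArcEnd N a b) := fun v => by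
  unfold IsMiddleArcEnd
  infer_instance

theorem mem_formEdges_iff_mirror (ha : a.sum ≤ N) (hb : b.sum ≤ N) {i j : Fin (2 * (N + 1))} :
    (i, j) ∈ formEdges (N + 1) a b ↔
      ((j : ℕ) < (ofList N a 0).mirror j ∧ (i : ℕ) = (ofList N a 0).mirror j) ∨
      ((ofList N b 0).mirror j < (j : ℕ) ∧ (i : ℕ) = (ofList N b 0).mirror j) ∨
      (IsMiddleArcEnd N a b j ∧ (i : ℕ) = 2 * N + 1 - j) := by
  have hj := j.2
  have hupper (h : (j : ℕ) < N) := (⟨IsArc.symm, IsArc.symm⟩ : IsArc _ _ _ ↔ _).trans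
    (isArc_fullComposition (n := N + 1) (a := a) (i := j) (j := i) (by omega) (by omega) N)
  have hlower (h : (i : ℕ) < N) :=
    isArc_fullComposition (n := N + 1) (a := b) (i := i) (j := j) (by omega) (by omega) N
  have hPj (h : a.sum ≤ (j : ℕ)) : (ofList N a 0).mirror j = j :=
    ofList_mirror_of_sum_le (by omega)
  have hQj (h : b.sum ≤ (j : ℕ)) : (ofList N b 0).mirror j = j :=
    ofList_mirror_of_sum_le (by omega)
  have hQi (h : b.sum ≤ (i : ℕ)) : (ofList N b 0).mirror i = i :=
    ofList_mirror_of_sum_le (by omega)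
  have hQ : (j : ℕ) = (ofList N b 0).mirror i ↔ (i : ℕ) = (ofList N b 0).mirror j := by
    rw [eq_comm, (ofList_mirror_involutive N b 0).eq_iff]
  rw [mem_formEdges, OrientedFullMeanderEdge, IsMiddleArcEnd, Nat.add_sub_cancel]
  dsimp only
  constructor
  · rintro ⟨⟨hji, harc⟩ | ⟨hij, harc⟩, hlt⟩
    · rw [hupper (by omega)] at harc
      omega
    · rw [hlower (by omega), hQ] at harc
      omega
  · rintro (⟨hji, heq⟩ | ⟨hij, heq⟩ | ⟨⟨hsum, hlt⟩ | ⟨hsum, hlt⟩, heq⟩)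
    · have hjN : (j : ℕ) < N := by omega
      exact ⟨Or.inl ⟨by omega, (hupper hjN).2 ⟨by omega, by omega⟩⟩, Or.inr hjN⟩
    · have hiN : (i : ℕ) < N := by omega
      exact ⟨Or.inr ⟨by omega, (hlower hiN).2 ⟨by omega, by omega⟩⟩, Or.inl hiN⟩
    · exact ⟨Or.inl ⟨by omega, (hupper hlt).2 ⟨by omega, by omega⟩⟩, Or.inr hlt⟩
    · have hiN : (i : ℕ) < N := by omega
      exact ⟨Or.inr ⟨by omega, (hlower hiN).2 ⟨by omega, by omega⟩⟩, Or.inl hiN⟩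

/-- The matrix which represents `aftertailForm` through the trace form. -/
noncomputable def formMatrix (hn : 0 < n) (a b : List ℕ) : Matrix (Fin (2 * n)) (Fin (2 * n)) ℂ :=
  Matrix.single (idxN hn) (idxN hn) 1 + ∑ p ∈ formEdges n a b, Matrix.single p.2 p.1 1

theorem aftertailForm_apply (hn : 0 < n) (y : seaweed n a b) :
    aftertailForm hn a b y = (formMatrix hn a b * y.1).trace := by
  rw [aftertailForm, LinearMap.add_apply, LinearMap.sum_apply, formMatrix, add_mul,
    Finset.sum_mul, Matrix.trace_add, Matrix.trace_sum]
  simp only [Matrix.trace_single_mul, one_smul]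
  rfl

theorem kirillovForm_aftertailForm_apply (hn : 0 < n) (x y : seaweed n a b) :
    kirillovForm (aftertailForm hn a b) x y = (⁅formMatrix hn a b, x.1⁆ * y.1).trace := by
  change aftertailForm hn a b ⁅x, y⁆ = _
  rw [aftertailForm_apply, LieSubalgebra.coe_bracket, Ring.lie_def, Ring.lie_def, mul_sub, sub_mul,
    Matrix.trace_sub, Matrix.trace_sub, ← mul_assoc, ← mul_assoc,
    Matrix.trace_mul_cycle _ y.1 x.1]

theorem transpose_formMatrix (hn : 0 < n) (a b : List ℕ) :
    (formMatrix hn a b).transpose = formMatrix hn b a := by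
  rw [formMatrix, formMatrix, Matrix.transpose_add, Matrix.transpose_sum, Matrix.transpose_single]
  congr 1
  simp only [Matrix.transpose_single]
  exact Finset.sum_bij' (fun p _ => p.swap) (fun p _ => p.swap) (fun _ => swap_mem_formEdges)
    (fun _ => swap_mem_formEdges) (fun _ _ => rfl) (fun _ _ => rfl) fun _ _ => rfl

theorem formMatrix_apply (hn : 0 < n) (v k : Fin (2 * n)) :
    formMatrix hn a b v k =
      (if idxN hn = v ∧ idxN hn = k then 1 else 0) +
        open Classical in if (k, v) ∈ formEdges n a b then 1 else 0 := by
  classical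
  rw [formMatrix, Matrix.add_apply, Matrix.sum_apply, Matrix.single_apply]
  congr 1
  simp_rw [Matrix.single_apply, and_comm (b := _ = k), ← Prod.mk.injEq, Prod.mk.eta]
  exact Finset.sum_ite_eq' _ _ _

section Extend

variable {R : Type*} {m : ℕ}

/-- A finite square matrix, completed by zeros. -/
def extend [Zero R] (x : Matrix (Fin m) (Fin m) R) : Matrix ℕ ℕ R :=
  Matrix.of fun i j => if h : i < m ∧ j < m then x ⟨i, h.1⟩ ⟨j, h.2⟩ else 0

theorem extend_coe [Zero R] (x : Matrix (Fin m) (Fin m) R) (i j : Fin m) :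
    extend x i j = x i j := by
  simp [extend]

theorem transpose_extend [Zero R] (x : Matrix (Fin m) (Fin m) R) :
    (extend x).transpose = extend x.transpose := by
  ext i j
  simp [extend, and_comm]

theorem sum_ite_extend [AddCommMonoid R] (x : Matrix (Fin m) (Fin m) R) (P : Prop)
    [Decidable P] (k u : ℕ) :
    (∑ i : Fin m, if P ∧ (i : ℕ) = k then extend x i u else 0) =
      if P then extend x k u else 0 := by
  by_cases hP : P
  swap
  · simp [hP]
  simp only [hP, true_and, if_true]
  by_cases hk : k < m
  · rw [Finset.sum_eq_single ⟨k, hk⟩ (fun i _ hi => if_neg fun h => hi (Fin.ext h)) (by simp)]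
    exact if_pos rfl
  · rw [Finset.sum_eq_zero fun i _ => if_neg (by omega)]
    exact (dif_neg fun h : k < m ∧ u < m => hk h.1 : extend x k u = 0).symm

end Extend

/-- The entry `(v, u)` of the product of `formMatrix` with `X`, where `n = N + 1`. -/
noncomputable def formRow (N : ℕ) (a b : List ℕ) (X : Matrix ℕ ℕ ℂ) (v u : ℕ) : ℂ :=
  (if v = N then X N u else 0) + arcRow (ofList N a 0) (ofList N b 0) X v u +
    if IsMiddleArcEnd N a b v then X (2 * N + 1 - v) u else 0

theorem formMatrix_mul_apply (ha : a.sum ≤ N) (hb : b.sum ≤ N)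
    (x : Matrix (Fin (2 * (N + 1))) (Fin (2 * (N + 1))) ℂ) (v u : Fin (2 * (N + 1))) :
    (formMatrix N.add_one_pos a b * x) v u = formRow N a b (extend x) v u := by
  classical
  have hP (h : a.sum ≤ (v : ℕ)) : (ofList N a 0).mirror v = v :=
    ofList_mirror_of_sum_le (by omega)
  have hQ (h : b.sum ≤ (v : ℕ)) : (ofList N b 0).mirror v = v :=
    ofList_mirror_of_sum_le (by omega)
  rw [formRow, arcRow, ← sum_ite_extend x, ← sum_ite_extend x, ← sum_ite_extend x,
    ← sum_ite_extend x, Matrix.mul_apply]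
  simp only [formMatrix_apply, ← Finset.sum_add_distrib]
  refine Finset.sum_congr rfl fun k _ => ?_
  have hcorner : (idxN N.add_one_pos = v ∧ idxN N.add_one_pos = k) ↔ (v : ℕ) = N ∧ (k : ℕ) = N := by
    rw [Fin.ext_iff, Fin.ext_iff]
    exact and_congr eq_comm eq_comm
  rw [add_mul, ite_mul, ite_mul, one_mul, zero_mul, ← extend_coe x, if_congr hcorner rfl rfl,
    add_assoc]
  congr 1
  rw [if_congr (mem_formEdges_iff_mirror ha hb) rfl rfl]
  grind [IsMiddleArcEnd]

/-- The entry `(v, u)` of the bracket of `formMatrix` with `X`, where `n = N + 1`. -/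
noncomputable def formBracket (N : ℕ) (a b : List ℕ) (X : Matrix ℕ ℕ ℂ) (v u : ℕ) : ℂ :=
  formRow N a b X v u - formRow N b a X.transpose u v

theorem formBracket_transpose (N : ℕ) (a b : List ℕ) (X : Matrix ℕ ℕ ℂ) (v u : ℕ) :
    formBracket N b a X.transpose u v = -formBracket N a b X v u := by
  rw [formBracket, formBracket, Matrix.transpose_transpose, neg_sub]

theorem lie_formMatrix_apply (ha : a.sum ≤ N) (hb : b.sum ≤ N)
    (x : Matrix (Fin (2 * (N + 1))) (Fin (2 * (N + 1))) ℂ) (v u : Fin (2 * (N + 1))) :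
    ⁅formMatrix N.add_one_pos a b, x⁆ v u = formBracket N a b (extend x) v u := by
  have hright : x * formMatrix N.add_one_pos a b =
      (formMatrix N.add_one_pos b a * x.transpose).transpose := by
    rw [Matrix.transpose_mul, Matrix.transpose_transpose, transpose_formMatrix]
  rw [Ring.lie_def, Matrix.sub_apply, formMatrix_mul_apply ha hb, hright, Matrix.transpose_apply,
    formMatrix_mul_apply hb ha, formBracket, transpose_extend]

theorem formMatrix_apply_eq_zero (ha : a.sum ≤ N) (hb : b.sum ≤ N) {v w : Fin (2 * (N + 1))}
    (hw : (w : ℕ) = N ∨ (w : ℕ) = N + 1) (hvw : v ≠ w) :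
    formMatrix N.add_one_pos a b v w = 0 := by
  have hP : (ofList N a 0).mirror ((ofList N a 0).mirror v) = v :=
    ofList_mirror_involutive N a 0 v
  have hQ : (ofList N b 0).mirror ((ofList N b 0).mirror v) = v :=
    ofList_mirror_involutive N b 0 v
  have hPw : (ofList N a 0).mirror w = w := ofList_mirror_of_sum_le (by omega)
  have hQw : (ofList N b 0).mirror w = w := ofList_mirror_of_sum_le (by omega)
  have hedge : (w, v) ∉ formEdges (N + 1) a b := by
    rw [mem_formEdges_iff_mirror ha hb, IsMiddleArcEnd]
    rintro (⟨hlt, heq⟩ | ⟨hlt, heq⟩ | ⟨h, heq⟩)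
    · rw [← heq] at hP
      omega
    · rw [← heq] at hQ
      omega
    · omega
  rw [formMatrix_apply, if_neg hedge, if_neg fun h => hvw (h.1.symm.trans h.2), add_zero]

theorem commute_formMatrix_single (ha : a.sum ≤ N) (hb : b.sum ≤ N) {w : Fin (2 * (N + 1))}
    (hw : (w : ℕ) = N ∨ (w : ℕ) = N + 1) :
    Commute (formMatrix N.add_one_pos a b) (Matrix.single w w 1) := by
  ext v u
  by_cases hv : v = w <;> by_cases hu : u = w
  · simp [hv, hu]
  · have h := formMatrix_apply_eq_zero hb ha hw hu
    rw [← transpose_formMatrix, Matrix.transpose_apply] at h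
    simp [hv, hu, h]
  · simp [hv, hu, formMatrix_apply_eq_zero ha hb hw hv]
  · simp [hv, hu]

end AftertailForm

/-! ### Reduction to the kernel equations -/

section Kernel

variable {N i j : ℕ} {a b : List ℕ}

theorem admissible_iff_allowed (ha : a.sum ≤ N) (hb : b.sum ≤ N) (hi : i < N) (hj : j < N) :
    Admissible (N + 1) a b i j ↔ Allowed (ofList N a 0) (ofList N b 0) i j := by
  rw [Admissible, Allowed, sameBlock_fullComposition (by omega) (by omega),
    sameBlock_fullComposition (by omega) (by omega),
    ofList_rel_congr (N := 2 * (N + 1) - a.sum) (M := N) (by omega) (by omega),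
    ofList_rel_congr (N := 2 * (N + 1) - b.sum) (M := N) (by omega) (by omega)]

theorem admissible_of_le (hb : b.sum ≤ N) (hi : b.sum ≤ i) (hij : i ≤ j)
    (hj : j ≤ 2 * N + 1 - b.sum) : Admissible (N + 1) a b i j := by
  refine Or.inr ⟨hij, ?_⟩
  rw [sameBlock_fullComposition (by omega) (by omega), ofList_rel_of_sum_le (by omega)]
  omega

theorem not_admissible_of_sum_le (ha : a.sum = N) (hi : N ≤ i) (hj : j < N) :
    ¬ Admissible (N + 1) a b i j := by
  rintro (⟨-, h⟩ | ⟨hij, -⟩)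
  · have hrel := (sameBlock_fullComposition (by omega) (by omega)).1 h.symm
    have := (ofList_rel_of_sum_le (by omega)).1 ((ofList _ a 0).symm hrel)
    omega
  · omega

theorem not_admissible_of_lt_sum (hb : b.sum ≤ N) (hi : i < b.sum) (hj : N ≤ j) :
    ¬ Admissible (N + 1) a b i j := by
  rintro (⟨hji, -⟩ | ⟨-, h⟩)
  · omega
  · have hrel := (sameBlock_fullComposition (by omega) (by omega)).1 h
    have := (ofList_rel_of_sum_le (by omega)).1 ((ofList _ b 0).symm hrel)
    omega

theorem not_admissible_of_lt (hb : b.sum ≤ N) (hi : i ≤ N) (hj : 2 * N + 1 - b.sum < j) :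
    ¬ Admissible (N + 1) a b i j := by
  rintro (⟨hji, -⟩ | ⟨-, h⟩)
  · omega
  · have hrel := (sameBlock_fullComposition (by omega) (by omega)).1 h
    have := ofList_rel_lt (by omega) ((ofList _ b 0).symm hrel)
    omega

/-- The matrix `X`, indexed by `0, …, 2N + 1` and completed by zeros, is in the seaweed for
`n = N + 1`, and its bracket with `formMatrix` pairs to zero with the elements
`e_{u,v} - ε_u ε_v e_{2n+1-v,2n+1-u}` which span the seaweed. -/
structure IsKernelMatrix (N : ℕ) (a b : List ℕ) (X : Matrix ℕ ℕ ℂ) : Prop where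
  support : ∀ {i j}, ¬ Admissible (N + 1) a b i j → X i j = 0
  symplectic : ∀ {i j}, i ≤ 2 * N + 1 → j ≤ 2 * N + 1 →
    X (2 * N + 1 - j) (2 * N + 1 - i) = -(halfSign (N + 1) i * halfSign (N + 1) j) * X i j
  bracket : ∀ {u v}, u ≤ 2 * N + 1 → v ≤ 2 * N + 1 → Admissible (N + 1) a b u v →
    formBracket N a b X v u = halfSign (N + 1) u * halfSign (N + 1) v *
      formBracket N a b X (2 * N + 1 - u) (2 * N + 1 - v)

/-- The part of `X` in the first `N` rows and columns. -/
def leftBlock (N : ℕ) (X : Matrix ℕ ℕ ℂ) : Matrix ℕ ℕ ℂ :=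
  Matrix.of fun i j => if i < N ∧ j < N then X i j else 0

/-- The part of `X` in the rows `[t, N)` and their mirror columns, reflected into the square with
rows and columns `[t, N)` and symmetrized. -/
def upperCorner (N t : ℕ) (X : Matrix ℕ ℕ ℂ) : Matrix ℕ ℕ ℂ :=
  Matrix.of fun j i => if i ∈ Set.Ico t N ∧ j ∈ Set.Ico t N then
    X j (2 * N + 1 - i) + X i (2 * N + 1 - j) else 0

namespace IsKernelMatrix

variable {X : Matrix ℕ ℕ ℂ}

theorem transpose (h : IsKernelMatrix N a b X) : IsKernelMatrix N b a X.transpose where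
  support hij := h.support fun hji => hij hji.swap
  symplectic {i j} hi hj := by
    rw [Matrix.transpose_apply, Matrix.transpose_apply, h.symplectic hj hi,
      mul_comm (halfSign _ j)]
  bracket hu hv huv := by
    rw [formBracket_transpose, formBracket_transpose, h.bracket hv hu huv.swap, mul_neg,
      mul_comm (halfSign _ _)]

theorem rev_eq_neg (h : IsKernelMatrix N a b X) (hi : i ≤ N) (hj : j ≤ N) :
    X (2 * N + 1 - j) (2 * N + 1 - i) = -X i j := by
  rw [h.symplectic (by omega) (by omega), halfSign_of_lt (Nat.lt_succ_of_le hi),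
    halfSign_of_lt (Nat.lt_succ_of_le hj), one_mul, neg_one_mul]

theorem rev_eq (h : IsKernelMatrix N a b X) (hi : i ≤ N) (hj : N < j) (hj' : j ≤ 2 * N + 1) :
    X (2 * N + 1 - j) (2 * N + 1 - i) = X i j := by
  rw [h.symplectic (by omega) hj', halfSign_of_lt (Nat.lt_succ_of_le hi), halfSign_of_le hj,
    one_mul, neg_neg, one_mul]

section TopHeavy

variable (h : IsKernelMatrix N a b X) (ha : a.sum = N) (hb : b.sum ≤ N)
include h ha

theorem apply_eq_zero_of_lower (hi : N ≤ i) (hj : j < N) : X i j = 0 :=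
  h.support (not_admissible_of_sum_le ha hi hj)

theorem formBracket_of_lt (hi : i < N) (hj : j < N) :
    formBracket N a b X j i =
      arcBracket (ofList N a 0) (ofList N b 0) X j i -
        if b.sum ≤ i then X j (2 * N + 1 - i) else 0 := by
  have hendj : (if IsMiddleArcEnd N a b j then X (2 * N + 1 - j) i else 0) = 0 :=
    ite_eq_right_iff.2 fun _ => h.apply_eq_zero_of_lower ha (by omega) hi
  have hendi : IsMiddleArcEnd N b a i ↔ b.sum ≤ i := by
    rw [IsMiddleArcEnd]
    omega
  rw [formBracket, formRow, formRow, hendj, if_neg hj.ne, if_neg hi.ne, if_congr hendi rfl rfl,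
    arcBracket, Matrix.transpose_apply]
  ring

include hb

theorem formBracket_of_le (hi : b.sum ≤ i) (hj : N ≤ j) :
    formBracket N a b X j i =
      (if j = N then X N i else 0) +
        (if b.sum ≤ 2 * N + 1 - j ∧ 2 * N + 1 - j < N then X (2 * N + 1 - j) i else 0) -
      ((if i = N then X j N else 0) + if b.sum ≤ i ∧ i < N then X j (2 * N + 1 - i) else 0) := by
  have hPj : (ofList N a 0).mirror j = j := ofList_mirror_of_sum_le (by omega)
  have hQj : (ofList N b 0).mirror j = j := ofList_mirror_of_sum_le (by omega)
  have hQi : (ofList N b 0).mirror i = i := ofList_mirror_of_sum_le (by omega)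
  have harc : (if (ofList N a 0).mirror i < i then X j ((ofList N a 0).mirror i) else 0) = 0 := by
    refine ite_eq_right_iff.2 fun hlt => h.apply_eq_zero_of_lower ha hj ?_
    rcases lt_or_ge i N with hiN | hiN
    · exact mapsTo_ofList_mirror_Iio (by omega) hiN
    · exact absurd (ofList_mirror_of_sum_le (by omega)) hlt.ne
  have hendj : IsMiddleArcEnd N a b j ↔ b.sum ≤ 2 * N + 1 - j ∧ 2 * N + 1 - j < N := by
    rw [IsMiddleArcEnd]
    omega
  have hendi : IsMiddleArcEnd N b a i ↔ b.sum ≤ i ∧ i < N := by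
    rw [IsMiddleArcEnd]
    omega
  simp only [formBracket, formRow, arcRow, Matrix.transpose_apply, hPj, hQj, hQi, harc, hendj,
    hendi, lt_irrefl, if_false, add_zero]

theorem two_mul_symm_part (hi : b.sum ≤ i) (hi' : i ≤ N) (hj : b.sum ≤ j) (hj' : j ≤ N) :
    2 * ((if j < N then X j i else 0) + if i < N then X i j else 0) =
      (if i = N then X (2 * N + 1 - j) N else 0) + if j = N then X (2 * N + 1 - i) N else 0 := by
  have hE := h.bracket (by omega) (by omega)
    (admissible_of_le hb hi (by omega) (Nat.sub_le_sub_left hj _))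
  have hii : 2 * N + 1 - (2 * N + 1 - i) = i := by omega
  have hjj : 2 * N + 1 - (2 * N + 1 - j) = j := by omega
  rw [h.formBracket_of_le ha hb hi (by omega), h.formBracket_of_le ha hb (by omega) (by omega),
    hii, hjj, h.rev_eq_neg hi' hj', h.rev_eq_neg hj' hi', halfSign_of_lt (by omega),
    halfSign_of_le (by omega), if_neg (by omega : 2 * N + 1 - j ≠ N),
    if_neg (by omega : 2 * N + 1 - i ≠ N)] at hE
  simp only [hi, hj, true_and] at hE
  split_ifs at hE ⊢ <;> linear_combination hE

theorem apply_eq_neg (hi : b.sum ≤ i) (hi' : i < N) (hj : b.sum ≤ j) (hj' : j < N) :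
    X i j = -X j i := by
  have hE := h.two_mul_symm_part ha hb hi hi'.le hj hj'.le
  rw [if_pos hi', if_pos hj', if_neg hi'.ne, if_neg hj'.ne] at hE
  linear_combination hE / 2

theorem apply_column_eq_zero (hi : b.sum ≤ i) (hi' : i < N) : X i N = 0 := by
  have hE := h.two_mul_symm_part ha hb hi hi'.le hb le_rfl
  have hrev := h.symplectic (i := N + 1) (j := i) (by omega) (by omega)
  rw [h.apply_eq_zero_of_lower ha (by omega) hi', mul_zero, show 2 * N + 1 - (N + 1) = N by omega]
    at hrev
  rw [if_neg (lt_irrefl N), if_pos hi', if_neg hi'.ne, if_pos rfl, hrev] at hE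
  linear_combination hE / 2

theorem apply_succ_self_eq_zero : X (N + 1) N = 0 := by
  have hE := h.two_mul_symm_part ha hb hb le_rfl hb le_rfl
  rw [if_neg (lt_irrefl N), if_pos rfl, show 2 * N + 1 - N = N + 1 by omega] at hE
  linear_combination -hE / 2

theorem apply_column_succ_eq_zero (hi : b.sum ≤ i) (hi' : i < N) : X i (N + 1) = 0 := by
  have hE := h.bracket (by omega) (by omega) (admissible_of_le hb hi hi'.le (by omega))
  have hrev := h.rev_eq (j := N + 1) hi'.le (by omega) (by omega)
  rw [show 2 * N + 1 - (N + 1) = N by omega] at hrev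
  rw [h.formBracket_of_le ha hb hi le_rfl, h.formBracket_of_le ha hb (by omega) (by omega),
    Nat.sub_sub_self (by omega), hrev, h.apply_eq_zero_of_lower ha le_rfl hi',
    show 2 * N + 1 - N = N + 1 by omega, halfSign_of_lt (by omega : i < N + 1),
    halfSign_of_lt N.lt_succ_self] at hE
  simp (disch := omega) only [if_pos, if_neg, if_true] at hE
  linear_combination -hE / 2

theorem apply_self_succ_eq_zero : X N (N + 1) = 0 := by
  have hE := h.bracket (by omega) (by omega)
    (admissible_of_le ha.le ha.le N.le_succ (by omega)).swap
  rw [show 2 * N + 1 - (N + 1) = N by omega, show 2 * N + 1 - N = N + 1 by omega,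
    h.formBracket_of_le ha hb (by omega) le_rfl, halfSign_of_lt N.lt_succ_self,
    halfSign_of_le le_rfl] at hE
  simp (disch := omega) only [if_neg, if_true] at hE
  linear_combination hE / 2

theorem arcBracket_eq_upperCorner (hi : i < N) (hj : j < N)
    (hij : Admissible (N + 1) a b i j) :
    arcBracket (ofList N a 0) (ofList N b 0) X j i = upperCorner N b.sum X j i := by
  have hE := h.bracket (by omega) (by omega) hij
  have hii : 2 * N + 1 - (2 * N + 1 - i) = i := by omega
  rw [h.formBracket_of_lt ha hi hj, h.formBracket_of_le ha hb (by omega) (by omega), hii,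
    halfSign_of_lt (by omega), halfSign_of_lt (by omega)] at hE
  simp (disch := omega) only [if_neg] at hE
  rw [upperCorner, Matrix.of_apply]
  simp only [Set.mem_Ico, hi, hj, and_true] at hE ⊢
  by_cases hti : b.sum ≤ i
  · by_cases htj : b.sum ≤ j
    · rw [if_pos hti, if_pos hti] at hE
      rw [if_pos ⟨hti, htj⟩]
      linear_combination hE
    · rw [if_pos hti, if_pos hti, h.support (not_admissible_of_lt_sum hb (by omega) (by omega)),
        h.support (not_admissible_of_lt hb hi.le (by omega))] at hE
      rw [if_neg fun h => htj h.2]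
      linear_combination hE
  · rw [if_neg hti, if_neg hti] at hE
    rw [if_neg fun h => hti h.1]
    linear_combination hE

theorem isKernelPair : IsKernelPair (ofList N a 0) (ofList N b 0) (Set.Ico b.sum N)
    (leftBlock N X) (upperCorner N b.sum X) where
  support {i j} hij := ite_eq_right_iff.2 fun hlt =>
    h.support fun hadm => hij ((admissible_iff_allowed ha.le hb hlt.1 hlt.2).1 hadm)
  skew {i j} hi hj := by
    rw [leftBlock, Matrix.of_apply, Matrix.of_apply, if_pos ⟨hi.2, hj.2⟩, if_pos ⟨hj.2, hi.2⟩]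
    exact h.apply_eq_neg ha hb hi.1 hi.2 hj.1 hj.2
  isSymm := by
    ext i j
    rw [Matrix.transpose_apply, upperCorner, Matrix.of_apply, Matrix.of_apply, add_comm]
    exact if_congr and_comm rfl rfl
  eq_zero_off hij := if_neg fun h => hij h.symm
  bracket {i j} hij := by
    have hi : i < N := hij.elim
      (fun h => ofList_rel_lt (by omega) h.2) fun h => ofList_rel_lt (by omega) h.2
    have hj : j < N := hij.swap.elim
      (fun h => ofList_rel_lt (by omega) h.2) fun h => ofList_rel_lt (by omega) h.2
    rw [← h.arcBracket_eq_upperCorner ha hb hi hj ((admissible_iff_allowed ha.le hb hi hj).2 hij)]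
    exact arcBracket_congr (mapsTo_ofList_mirror_Iio (by omega))
      (mapsTo_ofList_mirror_Iio (by omega)) (fun k hk l hl => if_pos ⟨hk, hl⟩) hi hj

variable (hrigid : Rigid ℂ (ofList N a 0) (ofList N b 0) (Set.Ico b.sum N))
include hrigid

theorem apply_eq_zero_of_lt (hi : i < N) : X i j = 0 := by
  obtain ⟨hleft, hcorner⟩ := hrigid _ _ (h.isKernelPair ha hb)
  rcases lt_or_ge j N with hj | hj
  · have hij := congrFun₂ hleft i j
    rwa [leftBlock, Matrix.of_apply, if_pos ⟨hi, hj⟩] at hij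
  by_cases hti : i < b.sum
  · exact h.support (not_admissible_of_lt_sum hb hti hj)
  by_cases htj : 2 * N + 1 - b.sum < j
  · exact h.support (not_admissible_of_lt hb hi.le htj)
  obtain rfl | rfl | hj : j = N ∨ j = N + 1 ∨ N + 1 < j := by omega
  · exact h.apply_column_eq_zero ha hb (not_lt.1 hti) hi
  · exact h.apply_column_succ_eq_zero ha hb (not_lt.1 hti) hi
  have hij := congrFun₂ hcorner i (2 * N + 1 - j)
  have hjj : 2 * N + 1 - (2 * N + 1 - j) = j := by omega
  rw [upperCorner, Matrix.of_apply, if_pos (by simp only [Set.mem_Ico]; omega), hjj,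
    h.rev_eq hi.le (by omega) (by omega), Matrix.zero_apply] at hij
  linear_combination hij / 2

theorem apply_eq_zero (hi : i ≤ 2 * N + 1) (hj : j ≤ 2 * N + 1) (hN : ¬ (i = N ∧ j = N))
    (hsucc : ¬ (i = N + 1 ∧ j = N + 1)) : X i j = 0 := by
  have hrev (h0 : X (2 * N + 1 - j) (2 * N + 1 - i) = 0) : X i j = 0 := by
    have hε := h.symplectic hi hj
    rw [h0, zero_eq_mul, neg_eq_zero] at hε
    refine hε.resolve_left (mul_ne_zero ?_ ?_) <;>
      exact left_ne_zero_of_mul_eq_one (halfSign_mul_self _ _)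
  by_cases hiN : i < N
  · exact h.apply_eq_zero_of_lt ha hb hrigid hiN
  by_cases hjN : j < N
  · exact h.apply_eq_zero_of_lower ha (not_lt.1 hiN) hjN
  by_cases hj' : N + 1 < j
  · exact hrev (h.apply_eq_zero_of_lt ha hb hrigid (by omega))
  by_cases hi' : N + 1 < i
  · exact hrev (h.apply_eq_zero_of_lower ha (by omega) (by omega))
  obtain ⟨rfl, rfl⟩ | ⟨rfl, rfl⟩ : (i = N ∧ j = N + 1) ∨ (i = N + 1 ∧ j = N) := by omega
  · exact h.apply_self_succ_eq_zero ha hb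
  · exact h.apply_succ_self_eq_zero ha hb

end TopHeavy

end IsKernelMatrix

end Kernel

/-! ### The kernel -/

section KirillovForm

variable {n N q : ℕ} {a b : List ℕ}

theorem HomotopyTypeC.apply_eq_zero (hH : HomotopyTypeC (N + 1) a b [] (List.replicate q 1) 2)
    (ha : a.sum ≤ N + 1) (hb : b.sum ≤ N + 1) {X : Matrix ℕ ℕ ℂ} (h : IsKernelMatrix N a b X)
    {i j : ℕ} (hi : i ≤ 2 * N + 1) (hj : j ≤ 2 * N + 1) (hN : ¬ (i = N ∧ j = N))
    (hsucc : ¬ (i = N + 1 ∧ j = N + 1)) : X i j = 0 := by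
  have hrigid : Rigid ℂ (ofList N a 0) (ofList N b 0) (Set.Ico (N - q) N) :=
    hH.rigid ha hb (by omega)
  rcases hH.sum_add_one_eq ha hb with ⟨hasum, hbsum⟩ | ⟨hbsum, hasum⟩
  · rw [show N - q = b.sum by omega] at hrigid
    exact h.apply_eq_zero (by omega) (by omega) hrigid hi hj hN hsucc
  · rw [show N - q = a.sum by omega] at hrigid
    exact h.transpose.apply_eq_zero (by omega) (by omega) hrigid.flip hj hi (mt And.symm hN)
      (mt And.symm hsucc)

theorem isKernelMatrix_extend (ha : a.sum ≤ N) (hb : b.sum ≤ N)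
    {x : Matrix (Fin (2 * (N + 1))) (Fin (2 * (N + 1))) ℂ} (hx : x ∈ seaweed (N + 1) a b)
    (hker : ∀ y ∈ seaweed (N + 1) a b, (⁅formMatrix N.add_one_pos a b, x⁆ * y).trace = 0) :
    IsKernelMatrix N a b (extend x) where
  support {i j} hij := by
    rw [mem_seaweed_iff] at hx
    rw [extend, Matrix.of_apply]
    split_ifs with hlt
    · exact hx.2 ⟨i, hlt.1⟩ ⟨j, hlt.2⟩ hij
    · rfl
  symplectic {i j} hi hj := by
    have hrev := (mem_seaweed_iff.1 hx).1 ⟨i, by omega⟩ ⟨j, by omega⟩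
    rw [← extend_coe x, ← extend_coe x, Fin.val_rev, Fin.val_rev] at hrev
    rwa [show 2 * N + 1 - j = 2 * (N + 1) - (j + 1) by omega,
      show 2 * N + 1 - i = 2 * (N + 1) - (i + 1) by omega]
  bracket {u v} hu hv huv := by
    have htest := hker _ (single_sub_single_mem_seaweed (u := ⟨u, by omega⟩) (v := ⟨v, by omega⟩)
      (by omega) (by omega) huv)
    rw [mul_sub, mul_smul_comm, Matrix.trace_sub, Matrix.trace_smul, Matrix.trace_mul_single,
      Matrix.trace_mul_single, lie_formMatrix_apply ha hb, lie_formMatrix_apply ha hb, Fin.val_rev,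
      Fin.val_rev, sub_eq_zero] at htest
    simpa [show 2 * N + 1 - u = 2 * (N + 1) - (u + 1) by omega,
      show 2 * N + 1 - v = 2 * (N + 1) - (v + 1) by omega] using htest

theorem rev_idxN (hn : 0 < n) : (idxN hn).rev = idxNSucc hn := by
  rw [Fin.ext_iff, Fin.val_rev, idxN, idxNSucc]
  dsimp only
  omega

/-- The matrix `e_{n,n} - e_{n+1,n+1}`, the coroot of the long simple root of `𝔰𝔭(2n)`; it spans
the kernel. -/
abbrev middleCoroot (hn : 0 < n) : Matrix (Fin (2 * n)) (Fin (2 * n)) ℂ :=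
  Matrix.single (idxN hn) (idxN hn) 1 - Matrix.single (idxNSucc hn) (idxNSucc hn) 1

theorem middleCoroot_mem_seaweed (ha : a.sum < n) (hb : b.sum < n) (hn : 0 < n) :
    middleCoroot hn ∈ seaweed n a b := by
  obtain ⟨N, rfl⟩ : ∃ N, n = N + 1 := ⟨n - 1, by omega⟩
  have hadm : Admissible (N + 1) a b (idxN hn : Fin (2 * (N + 1))) (idxN hn) :=
    admissible_of_le (i := N) (j := N) (by omega) (by omega) le_rfl (by omega)
  have hmem := single_sub_single_mem_seaweed ha.le hb.le hadm
  rwa [halfSign_mul_self, one_smul, rev_idxN] at hmem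

theorem eq_smul_middleCoroot (hn : 0 < n) {x : Matrix (Fin (2 * n)) (Fin (2 * n)) ℂ}
    (hx : x ∈ seaweed n a b) (hzero : ∀ i j, ¬ (i = idxN hn ∧ j = idxN hn) →
      ¬ (i = idxNSucc hn ∧ j = idxNSucc hn) → x i j = 0) :
    x = x (idxN hn) (idxN hn) • middleCoroot hn := by
  have hne : idxN hn ≠ idxNSucc hn := by
    rw [Ne, Fin.ext_iff, idxN, idxNSucc]
    dsimp only
    omega
  ext i j
  by_cases hN : i = idxN hn ∧ j = idxN hn
  · obtain ⟨rfl, rfl⟩ := hN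
    simp [hne.symm]
  by_cases hsucc : i = idxNSucc hn ∧ j = idxNSucc hn
  · obtain ⟨rfl, rfl⟩ := hsucc
    have hrev := (mem_seaweed_iff.1 hx).1 (idxN hn) (idxN hn)
    rw [rev_idxN, halfSign_mul_self] at hrev
    simp [hne, hrev]
  · rw [hzero i j hN hsucc, Matrix.smul_apply, middleCoroot,
      Matrix.sub_apply,
      Matrix.single_apply_of_ne _ _ _ _ _ fun h => hN ⟨h.1.symm, h.2.symm⟩,
      Matrix.single_apply_of_ne _ _ _ _ _ fun h => hsucc ⟨h.1.symm, h.2.symm⟩, sub_zero, smul_zero]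

theorem lie_formMatrix_middleCoroot (ha : a.sum < n) (hb : b.sum < n) (hn : 0 < n) :
    ⁅formMatrix hn a b, middleCoroot hn⁆ = 0 := by
  obtain ⟨N, rfl⟩ : ∃ N, n = N + 1 := ⟨n - 1, by omega⟩
  rw [← commute_iff_lie_eq]
  exact (commute_formMatrix_single (by omega) (by omega) (Or.inl rfl)).sub_right
    (commute_formMatrix_single (by omega) (by omega) (Or.inr rfl))

theorem HomotopyTypeC.eq_smul_middleCoroot
    (hH : HomotopyTypeC n a b [] (List.replicate q 1) 2) (ha : a.sum ≤ n) (hb : b.sum ≤ n)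
    (hn : 0 < n) {x : seaweed n a b}
    (hx : x ∈ LinearMap.ker (kirillovForm (aftertailForm hn a b))) :
    x.1 = x.1 (idxN hn) (idxN hn) • middleCoroot hn := by
  obtain ⟨N, rfl⟩ : ∃ N, n = N + 1 := ⟨n - 1, by omega⟩
  have hsums := hH.sum_add_one_eq ha hb
  have hker (y) (hy : y ∈ seaweed (N + 1) a b) :
      (⁅formMatrix N.add_one_pos a b, x.1⁆ * y).trace = 0 := by
    rw [← kirillovForm_aftertailForm_apply hn x ⟨y, hy⟩, LinearMap.mem_ker.1 hx,
      LinearMap.zero_apply]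
  refine TypeCSeaweed.eq_smul_middleCoroot hn x.2 fun i j hN hsucc => ?_
  rw [← extend_coe x.1]
  refine hH.apply_eq_zero ha hb (isKernelMatrix_extend (by omega) (by omega) x.2 hker) (by omega)
    (by omega) ?_ ?_
  · exact fun h => hN ⟨Fin.ext h.1, Fin.ext h.2⟩
  · exact fun h => hsucc ⟨Fin.ext h.1, Fin.ext h.2⟩

end KirillovForm

end TypeCSeaweed

open TypeCSeaweed in
theorem theorem3p5 (n : ℕ) (hn : 0 < n) (a b : List ℕ)
    (ha : ∀ x ∈ a, 0 < x) (hb : ∀ x ∈ b, 0 < x) (hasum : a.sum ≤ n) (hbsum : b.sum ≤ n)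
    (q : ℕ) (hH : HomotopyTypeC n a b [] (List.replicate q 1) 2) :
    ∃ hmem : Matrix.single (idxN hn) (idxN hn) (1 : ℂ) -
        Matrix.single (idxNSucc hn) (idxNSucc hn) (1 : ℂ) ∈ seaweed n a b,
      LinearMap.ker (kirillovForm (aftertailForm hn a b)) =
        Submodule.span ℂ {(⟨_, hmem⟩ : seaweed n a b)} := by
  have hsums := hH.sum_add_one_eq hasum hbsum
  have hmem := middleCoroot_mem_seaweed (a := a) (b := b) (by omega) (by omega) hn
  refine ⟨hmem, le_antisymm (fun x hx => ?_) ?_⟩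
  · exact Submodule.mem_span_singleton.2
      ⟨_, Subtype.ext (hH.eq_smul_middleCoroot hasum hbsum hn hx).symm⟩
  · rw [Submodule.span_singleton_le_iff_mem, LinearMap.mem_ker]
    ext y
    rw [kirillovForm_aftertailForm_apply, lie_formMatrix_middleCoroot (by omega) (by omega),
      zero_mul, Matrix.trace_zero, LinearMap.zero_apply]
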